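/- Assume the Generalized Riemann Hypothesis: for every $q\ge 1$ and every Dirichlet character $\chi$ modulo $q$ (including $q=1$, where $L(s,\chi)=\zeta(s)$), every zero of $L(s,\chi)$ with positive real part has real part $1/2$. Let $k\ge 2$ be an integer; an integer $n \geq 1$ is called $k$-free if no prime $p$ satisfies $p^k\mid n$. Then there exists a multiplicative function $f:\mathbb{N}\to\{-1,0,1\}$, with $f(n)=0$ whenever $n$ is not $k$-free and $f(p)=\pm1$ at every prime $p$, such that for every $\varepsilon>0$ $$\sum_{n\le x} f(n)\ll_{f,k,\varepsilon} x^{1/(k+\frac12)+\varepsilon}\qquad (x\to\infty).$$ Moreover, such functions are obtained as follows. For every real non-principal Dirichlet character $\chi$ modulo $q$ (that is, $\chi$ takes values in $\{-1,0,1\}$), let $g:\mathbb{N}\to\{-1,1\}$ be the completely multiplicative function with $g(p)=\chi(p)$ for primes $p\nmid q$ and $g(p)=1$ for primes $p\mid q$. Then the function $f$ defined by $f(n)=g(n)$ if $n$ is $k$-free and $f(n)=0$ otherwise has all the properties above. -/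

import Mathlib

/-- The Generalized Riemann Hypothesis for Dirichlet `L`-functions: for every modulus `q ≥ 1` and
every Dirichlet character `χ` mod `q`, all zeros of `L(s, χ)` with positive real part have real
part `1/2`. The case `q = 1` is the Riemann Hypothesis for `ζ`. The point `s = 1` is left out for
principal characters, where `L(s, χ)` has a pole and Mathlib's `LFunction` takes a junk value. -/
def GeneralizedRiemannHypothesis : Prop :=
  ∀ (q : ℕ) [NeZero q] (χ : DirichletCharacter ℂ q) (s : ℂ), (χ ≠ 1 ∨ s ≠ 1) →
    DirichletCharacter.LFunction χ s = 0 → 0 < s.re → s.re = 1 / 2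

/-- `n` is `k`-free: it is not divisible by the `k`-th power of any prime. -/
def IsKFree (k n : ℕ) : Prop := ∀ p : ℕ, p.Prime → ¬ p ^ k ∣ n

/-- `f : ℕ → {-1, 0, 1}` is multiplicative, supported on the `k`-free integers, and `f p = ± 1` at
every prime `p`. -/
structure IsKFreeSignFunction (k : ℕ) (f : ArithmeticFunction ℤ) : Prop where
  isMultiplicative : f.IsMultiplicative
  values : ∀ n : ℕ, f n = -1 ∨ f n = 0 ∨ f n = 1
  support : ∀ n : ℕ, ¬ IsKFree k n → f n = 0
  primes : ∀ p : ℕ, p.Prime → f p = 1 ∨ f p = -1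

/-- The partial sum `∑_{n ≤ x} f(n)`. -/
noncomputable def partialSum (f : ArithmeticFunction ℤ) (x : ℝ) : ℤ := ∑ n ∈ Finset.Icc 1 ⌊x⌋₊, f n

/-- The completely multiplicative function `g` on the positive integers with `g p = 1` at the primes
`p ∣ q` and `g p = χ p` at the primes `p ∤ q`, for a real Dirichlet character `χ` mod `q`.
A real character is one with values in `ℤ`, that is, with values in `{-1, 0, 1}`. -/
def modifiedCharacter {q : ℕ} (χ : DirichletCharacter ℤ q) (n : ℕ) : ℤ :=
  n.factorization.prod fun p a => (if p ∣ q then 1 else χ (p : ZMod q)) ^ a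

open Classical in
/-- The restriction `μ_k² g` of the modified character `g` to the `k`-free integers. -/
noncomputable def kFreeModifiedCharacter (k : ℕ) {q : ℕ} (χ : DirichletCharacter ℤ q) :
    ArithmeticFunction ℤ where
  toFun n := if IsKFree k n then modifiedCharacter χ n else 0
  map_zero' := if_neg fun h => h 2 Nat.prime_two (dvd_zero _)

/-! ### Littlewood's bound for reciprocals of nonvanishing functions -/

section

open Complex Metric Set Filter Topology

/-! Write `g` for the modified character. Detecting `k`-freeness by `∑ μ d` over `d ^ k ∣ n`, and
using that `g` is completely multiplicative, turns the sum of `f` into a sum of `μ d * g d ^ k * g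
m` over `d ^ k * m ≤ N` (`sum_kFreeModifiedCharacter`). Both factors have strong cancellation.

The partial sums of `χ` are bounded, by periodicity and orthogonality. Passing from `χ` to `g` only
alters the primes dividing `q`, that is, it convolves with an indicator of integers built from
finitely many primes, and costs `N ^ η` (`exists_abs_sum_Icc_le_of_coprime`). So the sums of `g` are
`O(N ^ η)`. Since `g` has values `±1`, `μ * g ^ k` is `μ` for even `k` and `μ * g` for odd `k`; by
GRH, for `ζ` or for `χ`, its sums are `O(N ^ (1/2 + η))`.

In the hyperbola method (`abs_hyperbola_sum_le`) the range `d ≤ y` contributes about `y`. In the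
range `d > y` one has `m ≤ N / y ^ k`, and cancellation in `d` leaves about `N * y ^ (1/2 - k)`. The
two agree when `y ^ (k + 1/2) = N`, which gives the exponent.

The analytic input is that GRH bounds the sums of `χ * μ`
(`DirichletCharacter.exists_norm_sum_mul_moebius_le`). On discs centred at `2 + it` and inside `re s
> 1/2`, `L` has a holomorphic logarithm. Polynomial growth of `L`, Borel–Carathéodory and three
circles bound that logarithm by a power of `log |t|` with exponent below `1`, so `1 / L` grows more
slowly than any power of `|t|`. A Perron integral can then be moved to `re s = 1/2 + θ`. To keep it
absolutely convergent, the sharp sum is written as a difference of two Riesz means. -/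

/-- A nonvanishing holomorphic function on a disc has a holomorphic logarithm. -/
theorem exists_log_on_ball {F : ℂ → ℂ} {R : ℝ} (hR : 0 < R) (hF : DifferentiableOn ℂ F (ball 0 R))
    (hne : ∀ z ∈ ball (0 : ℂ) R, F z ≠ 0) (h0 : F 0 = 1) :
    ∃ f : ℂ → ℂ, DifferentiableOn ℂ f (ball 0 R) ∧ f 0 = 0 ∧
      ∀ z ∈ ball (0 : ℂ) R, exp (f z) = F z := by
  have hd : DifferentiableOn ℂ (fun z => deriv F z / F z) (ball 0 R) :=
    (hF.deriv isOpen_ball).div hF hne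
  obtain ⟨f, hf0, hf⟩ := hd.isExactOn_ball.with_val_at 0 0
  refine ⟨f, fun z hz => (hf z hz).differentiableAt.differentiableWithinAt, hf0, fun z hz => ?_⟩
  have hFd : ∀ w ∈ ball (0 : ℂ) R, HasDerivAt F (deriv F w) w := fun w hw =>
    (hF.differentiableAt (isOpen_ball.mem_nhds hw)).hasDerivAt
  -- Since `f` is a primitive of `F' / F`, the quotient `F * exp (-f)` is constant on the disc, and
  -- its value at `0` is `1`.
  have key : ∀ w ∈ ball (0 : ℂ) R, HasDerivAt (fun z => F z * exp (-f z)) 0 w := by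
    intro w hw
    have := (hFd w hw).mul ((hf w hw).neg.cexp)
    convert! this using 1
    field_simp [hne w hw]
    ring
  have hconst := (convex_ball (0 : ℂ) R).is_const_of_fderivWithin_eq_zero (𝕜 := ℂ)
    (f := fun z => F z * exp (-f z))
    (fun w hw => (key w hw).differentiableAt.differentiableWithinAt)
    (fun w hw => by
      rw [((key w hw).hasFDerivAt.hasFDerivWithinAt).fderivWithin
        (isOpen_ball.uniqueDiffWithinAt hw)]
      ext; simp) hz (mem_ball_self hR)
  simp only [h0, hf0, neg_zero, exp_zero, mul_one] at hconst
  rw [exp_neg, mul_inv_eq_one₀ (exp_ne_zero _)] at hconst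
  exact hconst.symm

/-- A form of Hadamard's three circles theorem. -/
theorem norm_le_mul_rpow_of_three_circles {r₁ r₂ r₃ : ℝ} (h1 : 0 < r₁) (h12 : r₁ < r₂)
    (h23 : r₂ < r₃) :
    ∃ θ : ℝ, 0 < θ ∧ θ < 1 ∧ ∀ (f : ℂ → ℂ) (R B M : ℝ), r₃ < R → 1 ≤ B → 1 ≤ M →
      DifferentiableOn ℂ f (ball 0 R) → (∀ z, ‖z‖ ≤ r₁ → ‖f z‖ ≤ B) →
      (∀ z, ‖z‖ ≤ r₃ → ‖f z‖ ≤ M) → ∀ z, ‖z‖ ≤ r₂ → ‖f z‖ ≤ B * M ^ θ := by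
  have hl12 := Real.log_lt_log h1 h12
  have hl23 := Real.log_lt_log (h1.trans h12) h23
  have hl13 := hl12.trans hl23
  refine ⟨(Real.log r₂ - Real.log r₁) / (Real.log r₃ - Real.log r₁),
    div_pos (by linarith) (by linarith), (div_lt_one (by linarith)).2 (by linarith), ?_⟩
  intro f R B M hR hB hM hf hfB hfM z hz
  set θ := (Real.log r₂ - Real.log r₁) / (Real.log r₃ - Real.log r₁) with hθ
  have hθ0 : 0 < θ := div_pos (by linarith) (by linarith)
  rcases le_or_gt ‖z‖ r₁ with h | h
  · calc ‖f z‖ ≤ B := hfB z h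
      _ ≤ B * M ^ θ := le_mul_of_one_le_right (by linarith) (Real.one_le_rpow hM hθ0.le)
  have hz0 : z ≠ 0 := norm_pos_iff.1 (h1.trans h)
  have hnorm : ∀ w : ℂ, ‖exp w‖ = Real.exp w.re := norm_exp
  have hle3 : ∀ w : ℂ, w.re ≤ Real.log r₃ → ‖exp w‖ ≤ r₃ := fun w hw => by
    rw [hnorm, ← Real.exp_log (h1.trans (h12.trans h23))]
    exact Real.exp_le_exp.2 hw
  have hdiff : ∀ w : ℂ, w.re ≤ Real.log r₃ → DifferentiableAt ℂ (fun w => f (exp w)) w := by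
    intro w hw
    refine DifferentiableAt.comp w (hf.differentiableAt (isOpen_ball.mem_nhds ?_))
      differentiableAt_exp
    rw [mem_ball_zero_iff]
    exact (hle3 w hw).trans_lt hR
  have hlz1 : Real.log r₁ < Real.log ‖z‖ := Real.log_lt_log h1 h
  have hlz2 : Real.log ‖z‖ ≤ Real.log r₂ := Real.log_le_log (h1.trans h) hz
  -- The exponential maps vertical lines to circles, so the three lines theorem for `f ∘ exp` is the
  -- three circles theorem for `f`.
  have key := HadamardThreeLines.norm_le_interp_of_mem_verticalClosedStrip'
    (f := fun w => f (exp w)) (z := log z) (a := B) (b := M) hl13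
    (by
      simp only [HadamardThreeLines.verticalClosedStrip, mem_preimage, log_re]
      exact ⟨hlz1.le, by linarith⟩)
    (by
      refine DifferentiableOn.diffContOnCl fun w hw => (hdiff w ?_).differentiableWithinAt
      have : closure (HadamardThreeLines.verticalStrip (Real.log r₁) (Real.log r₃)) ⊆
          re ⁻¹' (Iic (Real.log r₃)) :=
        closure_minimal (fun w hw => hw.2.le) (isClosed_Iic.preimage continuous_re)
      exact this hw)
    (by
      refine ⟨M, ?_⟩
      rintro _ ⟨w, hw, rfl⟩
      exact hfM _ (hle3 w hw.2))
    (fun w hw => hfB _ (by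
      rw [hnorm, show w.re = Real.log r₁ from hw, Real.exp_log h1]))
    (fun w hw => hfM _ (hle3 w (le_of_eq hw)))
  simp only [exp_log hz0, log_re] at key
  set τ := (Real.log ‖z‖ - Real.log r₁) / (Real.log r₃ - Real.log r₁)
  have hτθ : τ ≤ θ := div_le_div_of_nonneg_right (by linarith) (by linarith)
  have hτ0 : 0 ≤ τ := div_nonneg (by linarith) (by linarith)
  refine key.trans (mul_le_mul ?_ (Real.rpow_le_rpow_of_exponent_le hM hτθ)
    (Real.rpow_nonneg (by linarith) _) (by linarith))
  calc B ^ (1 - τ) ≤ B ^ (1 : ℝ) := Real.rpow_le_rpow_of_exponent_le hB (by linarith)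
    _ = B := Real.rpow_one B

/-- Littlewood's bound for the reciprocal of a nonvanishing function on a disc. -/
theorem norm_inv_le_exp_rpow_of_nonvanishing {ρ r R B : ℝ} (hρ : 0 < ρ) (hρr : ρ ≤ r) (hr : r < R)
    (hB : 0 < B) :
    ∃ θ C : ℝ, 0 < θ ∧ θ < 1 ∧ 0 < C ∧ ∀ (F : ℂ → ℂ) (M : ℝ), 1 ≤ M →
      DifferentiableOn ℂ F (ball 0 R) → (∀ z ∈ ball (0 : ℂ) R, F z ≠ 0) → F 0 = 1 →
      (∀ z ∈ ball (0 : ℂ) ρ, ‖F z‖ ≤ Real.exp B) → (∀ z ∈ ball (0 : ℂ) R, ‖F z‖ ≤ Real.exp M) →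
      ∀ z, ‖z‖ ≤ r → ‖F z‖⁻¹ ≤ Real.exp (C * M ^ θ) := by
  obtain ⟨θ, hθ0, hθ1, hθ⟩ := norm_le_mul_rpow_of_three_circles (r₁ := ρ / 2) (r₂ := r)
    (r₃ := (r + R) / 2) (by linarith) (by linarith) (by linarith)
  -- The outer circle stays strictly inside radius `R`, where the Borel–Carathéodory factor `2 * r₃
  -- / (R - r₃)` is finite. The maximum with `1` in `K` serves the requirement `1 ≤ K * M` of the
  -- three circles bound.
  set r₃ := (r + R) / 2 with hr₃
  have hr3R : r₃ < R := by simp only [r₃]; linarith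
  have hr3 : 0 < r₃ := by simp only [r₃]; linarith
  set K := max 1 (2 * r₃ / (R - r₃)) with hK
  have hK1 : 1 ≤ K := le_max_left _ _
  refine ⟨θ, max 1 (2 * B) * K ^ θ, hθ0, hθ1, by positivity, ?_⟩
  intro F M hM hF hne h0 hFB hFM z hz
  have hR : 0 < R := by linarith
  obtain ⟨f, hfd, hf0, hf⟩ := exists_log_on_ball hR hF hne h0
  have hre : ∀ (A : ℝ) (w : ℂ), w ∈ ball (0 : ℂ) R → ‖F w‖ ≤ Real.exp A → (f w).re ≤ A := by
    intro A w hw h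
    rw [← hf w hw, norm_exp] at h
    exact Real.exp_le_exp.1 h
  have hsub : ball (0 : ℂ) ρ ⊆ ball 0 R := ball_subset_ball (by linarith)
  have bound1 : ∀ w : ℂ, ‖w‖ ≤ ρ / 2 → ‖f w‖ ≤ max 1 (2 * B) := by
    intro w hw
    have hwρ : w ∈ ball (0 : ℂ) ρ := by rw [mem_ball_zero_iff]; linarith
    have := borelCaratheodory_zero hB (hfd.mono hsub)
      (fun u hu => hre B u (hsub hu) (hFB u hu)) hρ hwρ hf0
    refine this.trans (le_trans ?_ (le_max_right _ _))
    rw [div_le_iff₀ (by linarith)]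
    have := norm_nonneg w
    nlinarith
  have bound3 : ∀ w : ℂ, ‖w‖ ≤ r₃ → ‖f w‖ ≤ K * M := by
    intro w hw
    have hwR : w ∈ ball (0 : ℂ) R := by rw [mem_ball_zero_iff]; linarith
    have := borelCaratheodory_zero (by linarith : 0 < M) hfd
      (fun u hu => hre M u hu (hFM u hu)) hR hwR hf0
    refine this.trans ?_
    calc 2 * M * ‖w‖ / (R - ‖w‖) ≤ 2 * M * r₃ / (R - r₃) := by
          have := norm_nonneg w
          gcongr
      _ = (2 * r₃ / (R - r₃)) * M := by ring
      _ ≤ K * M := by gcongr; exact le_max_right _ _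
  have key := hθ f R _ (K * M) hr3R (le_max_left 1 (2 * B)) (by nlinarith) hfd bound1 bound3 z hz
  have hzR : z ∈ ball (0 : ℂ) R := by rw [mem_ball_zero_iff]; linarith
  rw [← hf z hzR, norm_exp, ← Real.exp_neg]
  refine Real.exp_le_exp.2 ?_
  calc -(f z).re ≤ ‖f z‖ := (neg_le_abs _).trans (abs_re_le_norm _)
    _ ≤ _ := key
    _ = _ := by rw [Real.mul_rpow (by linarith) (by linarith)]; ring

end

/-! ### Growth of Dirichlet L-functions by partial summation -/

section

open Complex Metric Set Filter Topology MeasureTheory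

/-- The partial sums of a periodic function deviate from a linear function by `O(1)`. -/
theorem exists_norm_sum_Icc_sub_le {q : ℕ} [NeZero q] (Φ : ZMod q → ℂ) :
    ∃ K : ℝ, 0 ≤ K ∧ ∀ N : ℕ,
      ‖∑ n ∈ Finset.Icc 1 N, Φ (n : ZMod q) - (∑ a, Φ a) / q * N‖ ≤ K := by
  set c := (∑ a, Φ a) / q with hc
  have hq : (q : ℂ) ≠ 0 := Nat.cast_ne_zero.2 (NeZero.ne q)
  set E : ℕ → ℂ := fun N => ∑ n ∈ Finset.range N, (Φ ((n : ZMod q) + 1) - c) with hE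
  have hEq : E q = 0 := by
    obtain ⟨m, rfl⟩ := Nat.exists_eq_succ_of_ne_zero (NeZero.ne q)
    have h1 : ∑ n ∈ Finset.range (m + 1), Φ ((n : ZMod (m + 1)) + 1) = ∑ a, Φ a := by
      rw [← Fin.sum_univ_eq_sum_range (fun n => Φ ((n : ZMod (m + 1)) + 1)),
        ← Equiv.sum_comp (Equiv.addRight (1 : ZMod (m + 1)))]
      refine Finset.sum_congr rfl fun i _ => ?_
      simp only [Equiv.coe_addRight]
      congr 2
      exact Fin.cast_val_eq_self (n := m + 1) i
    simp only [E, Finset.sum_sub_distrib, Finset.sum_const, Finset.card_range, nsmul_eq_mul]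
    rw [h1, hc]
    field_simp
    simp
  -- The mean has been removed, so a full period contributes `E q = 0`; hence `E` is periodic and
  -- takes finitely many values.
  have hper : Function.Periodic E q := by
    intro N
    simp only [E]
    rw [add_comm N q, Finset.sum_range_add]
    have : ∑ n ∈ Finset.range q, (Φ ((n : ZMod q) + 1) - c) = 0 := hEq
    rw [this, zero_add]
    simp
  refine ⟨∑ n ∈ Finset.range q, ‖E n‖, Finset.sum_nonneg fun _ _ => norm_nonneg _, fun N => ?_⟩
  have hEN : ∑ n ∈ Finset.Icc 1 N, Φ (n : ZMod q) - c * N = E N := by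
    simp only [E, Finset.sum_sub_distrib, Finset.sum_const, Finset.card_range, nsmul_eq_mul]
    rw [mul_comm c, ← Finset.Ico_add_one_right_eq_Icc, Finset.sum_Ico_eq_sum_range]
    simp [add_comm]
  rw [hEN, ← hper.map_mod_nat]
  exact Finset.single_le_sum (f := fun n => ‖E n‖) (fun _ _ => norm_nonneg _)
    (Finset.mem_range.2 (Nat.mod_lt _ (NeZero.pos q)))

/-- The remainder in the linear approximation of the partial sums of a function, cut off at `1`. -/
noncomputable def sumRemainder (a : ℕ → ℂ) (c : ℂ) : ℝ → ℂ :=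
  indicator (Ioi 1) fun t => ∑ n ∈ Finset.Icc 1 ⌊t⌋₊, a n - c * t

section

variable {a : ℕ → ℂ} {c : ℂ} {K : ℝ}

theorem measurable_sumRemainder : Measurable (sumRemainder a c) := by
  refine Measurable.indicator ?_ measurableSet_Ioi
  refine Measurable.sub ?_ (by fun_prop)
  exact (measurable_from_nat (f := fun N => ∑ n ∈ Finset.Icc 1 N, a n)).comp Nat.measurable_floor

theorem norm_sumRemainder_le (hK : 0 ≤ K)
    (h : ∀ N : ℕ, ‖∑ n ∈ Finset.Icc 1 N, a n - c * N‖ ≤ K) (t : ℝ) :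
    ‖sumRemainder a c t‖ ≤ K + ‖c‖ := by
  rw [sumRemainder]
  refine (norm_indicator_le_of_subset (t := Ioi 1) subset_rfl _ t).trans ?_
  by_cases ht : t ∈ Ioi (1 : ℝ)
  · rw [indicator_of_mem ht]
    have ht0 : (0 : ℝ) ≤ t := zero_le_one.trans (le_of_lt ht)
    have h2 : ‖c * ((⌊t⌋₊ : ℂ) - t)‖ ≤ ‖c‖ := by
      rw [norm_mul]
      refine mul_le_of_le_one_right (norm_nonneg _) ?_
      have : ((⌊t⌋₊ : ℂ) - t) = ((⌊t⌋₊ - t : ℝ) : ℂ) := by push_cast; rfl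
      rw [this, norm_real, Real.norm_eq_abs, abs_le]
      constructor <;> linarith [Nat.floor_le ht0, Nat.lt_floor_add_one t]
    calc ‖∑ n ∈ Finset.Icc 1 ⌊t⌋₊, a n - c * t‖
        = ‖(∑ n ∈ Finset.Icc 1 ⌊t⌋₊, a n - c * (⌊t⌋₊ : ℕ)) + c * ((⌊t⌋₊ : ℂ) - t)‖ := by ring_nf
      _ ≤ K + ‖c‖ := (norm_add_le _ _).trans (add_le_add (h _) h2)
  · rw [indicator_of_notMem ht, norm_zero]
    positivity

theorem sumRemainder_isBigO_atTop (hK : 0 ≤ K)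
    (h : ∀ N : ℕ, ‖∑ n ∈ Finset.Icc 1 N, a n - c * N‖ ≤ K) :
    sumRemainder a c =O[atTop] fun t => t ^ (-(0 : ℝ)) := by
  refine Asymptotics.IsBigO.of_bound (K + ‖c‖) (Eventually.of_forall fun t => ?_)
  simpa using norm_sumRemainder_le hK h t

/-- The cutoff makes the remainder vanish near `0`, so the Mellin transform meets no constraint
there and only the behaviour at infinity matters. -/
theorem sumRemainder_isBigO_nhds_zero (b : ℝ) :
    sumRemainder a c =O[𝓝[>] 0] fun t => t ^ (-b) := by
  have : sumRemainder a c =ᶠ[𝓝[>] 0] fun _ => 0 := by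
    filter_upwards [Ioo_mem_nhdsGT (zero_lt_one' ℝ)] with t ht
    exact indicator_of_notMem (by simpa using ht.2.le) _
  exact this.trans_isBigO (Asymptotics.isBigO_zero _ _)

theorem locallyIntegrableOn_sumRemainder (hK : 0 ≤ K)
    (h : ∀ N : ℕ, ‖∑ n ∈ Finset.Icc 1 N, a n - c * N‖ ≤ K) :
    LocallyIntegrableOn (sumRemainder a c) (Ioi 0) := by
  refine LocallyIntegrable.locallyIntegrableOn ?_ _
  refine (locallyIntegrable_const (K + ‖c‖)).mono measurable_sumRemainder.aestronglyMeasurable ?_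
  refine Eventually.of_forall fun t => (norm_sumRemainder_le hK h t).trans (Real.le_norm_self _)

theorem differentiableAt_mellin_sumRemainder (hK : 0 ≤ K)
    (h : ∀ N : ℕ, ‖∑ n ∈ Finset.Icc 1 N, a n - c * N‖ ≤ K) {s : ℂ} (hs : 0 < s.re) :
    DifferentiableAt ℂ (fun s => mellin (sumRemainder a c) (-s)) s := by
  have : DifferentiableAt ℂ (mellin (sumRemainder a c)) (-s) :=
    mellin_differentiableAt_of_isBigO_rpow (a := 0) (b := -s.re - 1)
      (locallyIntegrableOn_sumRemainder hK h) (sumRemainder_isBigO_atTop hK h) (by simpa using hs)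
      (sumRemainder_isBigO_nhds_zero _) (by simp)
  exact this.comp s differentiable_neg.differentiableAt

theorem mellin_sumRemainder (s : ℂ) : mellin (sumRemainder a c) (-s) =
    ∫ t in Ioi (1 : ℝ), (∑ n ∈ Finset.Icc 1 ⌊t⌋₊, a n - c * t) * (t : ℂ) ^ (-(s + 1)) := by
  rw [mellin, sumRemainder]
  simp_rw [← indicator_smul, smul_eq_mul]
  rw [setIntegral_indicator measurableSet_Ioi, inter_eq_right.2 (Ioi_subset_Ioi zero_le_one)]
  refine setIntegral_congr_fun measurableSet_Ioi fun t _ => ?_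
  rw [mul_comm]
  ring_nf

theorem norm_mellin_sumRemainder_le (hK : 0 ≤ K)
    (h : ∀ N : ℕ, ‖∑ n ∈ Finset.Icc 1 N, a n - c * N‖ ≤ K) {s : ℂ} (hs : 0 < s.re) :
    ‖mellin (sumRemainder a c) (-s)‖ ≤ (K + ‖c‖) / s.re := by
  rw [mellin_sumRemainder]
  have hint : IntegrableOn (fun t : ℝ => (K + ‖c‖) * t ^ (-s.re - 1)) (Ioi 1) :=
    (integrableOn_Ioi_rpow_of_lt (by linarith) zero_lt_one).const_mul _
  refine (norm_integral_le_of_norm_le hint ?_).trans (le_of_eq ?_)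
  · refine (ae_restrict_iff' measurableSet_Ioi).2 (Eventually.of_forall fun t ht => ?_)
    have ht0 : (0 : ℝ) < t := zero_lt_one.trans ht
    rw [norm_mul, norm_cpow_eq_rpow_re_of_pos ht0]
    have h2 := norm_sumRemainder_le hK h t
    rw [sumRemainder, indicator_of_mem ht] at h2
    have : (-(s + 1)).re = -s.re - 1 := by simp; ring
    rw [this]
    gcongr
  · rw [integral_const_mul, integral_Ioi_rpow_of_lt (by linarith) zero_lt_one]
    simp
    ring

/-- Abel summation: the linear part `c * t` integrates to the polar term and the bounded remainder
to a Mellin transform. The right-hand side is holomorphic for `re s > 0`, `s ≠ 1`, so the formula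
serves to continue the series. -/
theorem LSeries_eq_add_mellin_sumRemainder (hK : 0 ≤ K)
    (h : ∀ N : ℕ, ‖∑ n ∈ Finset.Icc 1 N, a n - c * N‖ ≤ K) {s : ℂ} (hs : 1 < s.re)
    (hsum : LSeriesSummable a s) :
    LSeries a s = c * s / (s - 1) + s * mellin (sumRemainder a c) (-s) := by
  have hO : (fun n : ℕ => ∑ k ∈ Finset.Icc 1 n, a k) =O[atTop] fun n => (n : ℝ) ^ (1 : ℝ) := by
    refine Asymptotics.IsBigO.of_bound (K + ‖c‖) ?_
    filter_upwards [eventually_ge_atTop 1] with n hn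
    have hn' : (1 : ℝ) ≤ n := by exact_mod_cast hn
    have : ‖∑ k ∈ Finset.Icc 1 n, a k‖ ≤ K + ‖c‖ * n := by
      calc _ = ‖(∑ k ∈ Finset.Icc 1 n, a k - c * n) + c * n‖ := by ring_nf
        _ ≤ K + ‖c‖ * n := (norm_add_le _ _).trans (add_le_add (h n) (by simp))
    simp only [Real.rpow_one, RCLike.norm_natCast]
    nlinarith [norm_nonneg c]
  rw [LSeries_eq_mul_integral a zero_le_one hs hsum hO, mellin_sumRemainder]
  have hs1 : s - 1 ≠ 0 := fun h0 => by
    have := congrArg re h0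
    simp at this
    linarith
  have hI1 : IntegrableOn (fun t : ℝ => c * (t : ℂ) ^ (-s)) (Ioi 1) :=
    (integrableOn_Ioi_cpow_of_lt (by simpa using hs) zero_lt_one).const_mul c
  have hI2 : IntegrableOn (fun t : ℝ =>
      (∑ n ∈ Finset.Icc 1 ⌊t⌋₊, a n - c * t) * (t : ℂ) ^ (-(s + 1))) (Ioi 1) := by
    have hm : MellinConvergent (sumRemainder a c) (-s) :=
      mellinConvergent_of_isBigO_rpow (a := 0) (b := -s.re - 1)
        (locallyIntegrableOn_sumRemainder hK h) (sumRemainder_isBigO_atTop hK h)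
        (by simp; linarith) (sumRemainder_isBigO_nhds_zero _) (by simp)
    refine (hm.mono_set (Ioi_subset_Ioi zero_le_one)).congr_fun (fun t ht => ?_) measurableSet_Ioi
    simp only [sumRemainder, indicator_of_mem ht, smul_eq_mul]
    rw [mul_comm]
    ring_nf
  have hsplit : ∫ t in Ioi (1 : ℝ), (∑ n ∈ Finset.Icc 1 ⌊t⌋₊, a n) * (t : ℂ) ^ (-(s + 1)) =
      (∫ t in Ioi (1 : ℝ), c * (t : ℂ) ^ (-s)) +
      ∫ t in Ioi (1 : ℝ), (∑ n ∈ Finset.Icc 1 ⌊t⌋₊, a n - c * t) * (t : ℂ) ^ (-(s + 1)) := by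
    rw [← integral_add hI1 hI2]
    refine setIntegral_congr_fun measurableSet_Ioi fun t ht => ?_
    have ht0 : (t : ℂ) ≠ 0 := ofReal_ne_zero.2 (zero_lt_one.trans ht).ne'
    have : (t : ℂ) ^ (-s) = t * (t : ℂ) ^ (-(s + 1)) := by
      conv_rhs => rw [← cpow_one (t : ℂ), cpow_one, neg_add, cpow_add _ _ ht0, cpow_neg_one]
      field_simp
    simp only [this]
    ring
  rw [hsplit, integral_const_mul, integral_Ioi_cpow_of_lt (by simpa using hs) zero_lt_one]
  simp only [ofReal_one, one_cpow]
  have : -s + 1 ≠ 0 := by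
    intro h0; apply hs1; linear_combination -h0
  field_simp
  ring

end

/-- Polynomial growth of Dirichlet `L`-functions in the half-plane `re s > 1 / 2`. -/
theorem exists_norm_LFunction_le {q : ℕ} [NeZero q] (χ : DirichletCharacter ℂ q) :
    ∃ C : ℝ, 1 ≤ C ∧ ∀ s : ℂ, 1 / 2 < s.re → 1 ≤ |s.im| →
      ‖DirichletCharacter.LFunction χ s‖ ≤ C * ‖s‖ := by
  obtain ⟨K, hK, h⟩ := exists_norm_sum_Icc_sub_le (fun a => χ a)
  set c := (∑ a, χ a) / q with hc
  have main : ∀ σ : ℝ, ∀ s : ℂ, 0 < s.re → 0 < σ * s.im → (σ = 1 ∨ σ = -1) →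
      DirichletCharacter.LFunction χ s =
        c * s / (s - 1) + s * mellin (sumRemainder (fun n => χ n) c) (-s) := by
    -- The sign `σ` selects the upper or lower quadrant of `re s > 0`. Each is convex and avoids the
    -- possible pole at `1`, so the identity theorem applies from the point `2 + σ * I`, near which
    -- the series converges.
    intro σ s hs hsi hσ
    set U : Set ℂ := re ⁻¹' (Ioi 0) ∩ (fun s => σ * s.im) ⁻¹' (Ioi 0) with hU
    have hUo : IsOpen U := (isOpen_Ioi.preimage continuous_re).inter
      (isOpen_Ioi.preimage (by fun_prop))
    have hUc : Convex ℝ U := by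
      refine Convex.inter ((convex_Ioi 0).linear_preimage reLm) ?_
      exact (convex_Ioi (0 : ℝ)).linear_preimage (σ • imLm)
    have hne : ∀ w ∈ U, w ≠ 1 := by
      rintro w ⟨_, hw⟩ rfl
      simp at hw
    have hf : DifferentiableOn ℂ (DirichletCharacter.LFunction χ) U := fun w hw =>
      (DirichletCharacter.differentiableAt_LFunction χ w
        (Or.inl (hne w hw))).differentiableWithinAt
    have hg : DifferentiableOn ℂ
        (fun s => c * s / (s - 1) + s * mellin (sumRemainder (fun n => χ n) c) (-s)) U := by
      intro w hw
      refine DifferentiableAt.differentiableWithinAt ?_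
      refine DifferentiableAt.add ?_ ?_
      · exact DifferentiableAt.div (by fun_prop) (by fun_prop) (sub_ne_zero.2 (hne w hw))
      · exact differentiableAt_id.mul (differentiableAt_mellin_sumRemainder hK h hw.1)
    have hz : (⟨2, σ⟩ : ℂ) ∈ U := by
      refine ⟨by simp, ?_⟩
      rcases hσ with rfl | rfl <;> simp
    refine (hf.analyticOnNhd hUo).eqOn_of_preconnected_of_eventuallyEq (hg.analyticOnNhd hUo)
      hUc.isPreconnected hz ?_ ⟨hs, hsi⟩
    have : {w : ℂ | 1 < w.re} ∈ 𝓝 (⟨2, σ⟩ : ℂ) :=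
      (isOpen_lt continuous_const continuous_re).mem_nhds (by simp)
    filter_upwards [this] with w hw
    rw [DirichletCharacter.LFunction_eq_LSeries χ hw]
    exact LSeries_eq_add_mellin_sumRemainder hK h hw (χ.LSeriesSummable_of_one_lt_re hw)
  refine ⟨1 + (‖c‖ + 2 * (K + ‖c‖)), by have := norm_nonneg c; linarith, fun s hs hsi => ?_⟩
  have hs0 : 0 < s.re := by linarith
  have heq : DirichletCharacter.LFunction χ s =
        c * s / (s - 1) + s * mellin (sumRemainder (fun n => χ n) c) (-s) := by
    rcases le_total 0 s.im with him | him
    · rw [abs_of_nonneg him] at hsi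
      exact main 1 s hs0 (by linarith) (Or.inl rfl)
    · rw [abs_of_nonpos him] at hsi
      exact main (-1) s hs0 (by linarith) (Or.inr rfl)
  have h1 : 1 ≤ ‖s - 1‖ := hsi.trans (by simpa using abs_im_le_norm (s - 1))
  have h2 := norm_mellin_sumRemainder_le hK h hs0
  have h3 : (K + ‖c‖) / s.re ≤ 2 * (K + ‖c‖) := by
    rw [div_le_iff₀ hs0]
    have := norm_nonneg c
    nlinarith
  rw [heq]
  have h4 : ‖c * s / (s - 1)‖ ≤ ‖c‖ * ‖s‖ := by
    rw [norm_div, norm_mul]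
    exact div_le_self (by positivity) h1
  calc _ ≤ ‖c * s / (s - 1)‖ + ‖s * mellin (sumRemainder (fun n => χ n) c) (-s)‖ :=
        norm_add_le _ _
    _ ≤ ‖c‖ * ‖s‖ + ‖s‖ * (2 * (K + ‖c‖)) := by
        rw [norm_mul]
        gcongr
        exact h2.trans h3
    _ ≤ _ := by nlinarith [norm_nonneg s]

end

/-! ### Contour shifts and the Perron kernel -/

section

open Complex Metric Set Filter Topology MeasureTheory

theorem integrable_one_add_abs_rpow_neg {β : ℝ} (hβ : 1 < β) :
    Integrable fun t : ℝ => (1 + |t|) ^ (-β) := by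
  simpa using integrable_one_add_norm (E := ℝ) (μ := volume) (r := β) (by simpa using hβ)

theorem integrable_vertical_line {H : ℂ → ℂ} {σ C β : ℝ} (hβ : 1 < β)
    (hH : Continuous fun t : ℝ => H (σ + t * I))
    (hb : ∀ t : ℝ, ‖H (σ + t * I)‖ ≤ C * (1 + |t|) ^ (-β)) :
    Integrable fun t : ℝ => H (σ + t * I) :=
  ((integrable_one_add_abs_rpow_neg hβ).const_mul C).mono' hH.aestronglyMeasurable
    (Eventually.of_forall hb)

/-- Moving a vertical line of integration in a strip of holomorphy with decay. -/
theorem integral_vertical_line_eq {H : ℂ → ℂ} {a b C β : ℝ} (hab : a ≤ b) (hβ : 1 < β)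
    (hH : DifferentiableOn ℂ H (re ⁻¹' Icc a b))
    (hb : ∀ s : ℂ, a ≤ s.re → s.re ≤ b → ‖H s‖ ≤ C * (1 + |s.im|) ^ (-β)) :
    ∫ t : ℝ, H (a + t * I) = ∫ t : ℝ, H (b + t * I) := by
  have hint : ∀ σ ∈ Icc a b, Integrable fun t : ℝ => H (σ + t * I) := by
    intro σ hσ
    refine integrable_vertical_line (C := C) hβ ?_ fun t => ?_
    · exact hH.continuousOn.comp_continuous (by fun_prop) fun t => by simpa using hσ
    · simpa using hb (σ + t * I) (by simpa using hσ.1) (by simpa using hσ.2)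
  have hlim : ∀ σ ∈ Icc a b, Tendsto (fun T : ℝ => ∫ t in (-T)..T, H (σ + t * I)) atTop
      (𝓝 (∫ t : ℝ, H (σ + t * I))) := fun σ hσ =>
    intervalIntegral_tendsto_integral (hint σ hσ) tendsto_neg_atTop_atBot tendsto_id
  have hpow : Tendsto (fun T : ℝ => C * (1 + |T|) ^ (-β) * |b - a|) atTop (𝓝 0) := by
    have h1 : Tendsto (fun T : ℝ => 1 + |T|) atTop atTop :=
      tendsto_atTop_add_const_left _ _ tendsto_abs_atTop_atTop
    have h2 := (tendsto_rpow_neg_atTop (by linarith : 0 < β)).comp h1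
    simpa using (h2.const_mul C).mul_const |b - a|
  have hhor : ∀ T : ℝ, ‖∫ x : ℝ in a..b, H (x + T * I)‖ ≤ C * (1 + |T|) ^ (-β) * |b - a| := by
    intro T
    refine intervalIntegral.norm_integral_le_of_norm_le_const fun x hx => ?_
    rw [uIoc_of_le hab] at hx
    simpa using hb (x + T * I) (by simpa using hx.1.le) (by simpa using hx.2)
  have hhor1 : Tendsto (fun T : ℝ => ∫ x : ℝ in a..b, H (x + T * I)) atTop (𝓝 0) :=
    squeeze_zero_norm hhor hpow
  have hhor2 : Tendsto (fun T : ℝ => ∫ x : ℝ in a..b, H (x + (-T : ℝ) * I)) atTop (𝓝 0) :=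
    squeeze_zero_norm (fun T => by simpa only [abs_neg] using hhor (-T)) hpow
  have hrect : ∀ T : ℝ, (∫ x : ℝ in a..b, H (x + (-T : ℝ) * I)) - (∫ x : ℝ in a..b, H (x + T * I)) +
      I • (∫ y : ℝ in (-T)..T, H (b + y * I)) - I • (∫ y : ℝ in (-T)..T, H (a + y * I)) = 0 := by
    intro T
    have := integral_boundary_rect_eq_zero_of_differentiableOn H ⟨a, -T⟩ ⟨b, T⟩ (hH.mono ?_)
    · exact this
    · intro s hs
      have := hs.1
      rwa [uIcc_of_le hab] at this
  have hl := ((hhor2.sub hhor1).add ((hlim b ⟨hab, le_rfl⟩).const_smul I)).sub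
    ((hlim a ⟨le_rfl, hab⟩).const_smul I)
  have h0 := tendsto_nhds_unique (hl.congr hrect) tendsto_const_nhds
  simp only [sub_zero, zero_add, smul_eq_mul] at h0
  rw [← mul_sub] at h0
  rcases mul_eq_zero.1 h0 with h | h
  · exact absurd h I_ne_zero
  · exact (sub_eq_zero.1 h).symm

theorem one_add_abs_im_le {s : ℂ} (hs : 1 / 2 ≤ s.re) : 1 + |s.im| ≤ 3 * ‖s‖ := by
  have h1 := abs_im_le_norm s
  have h2 := (le_abs_self _).trans (abs_re_le_norm s)
  linarith

theorem norm_le_norm_add_one {s : ℂ} (hs : 1 / 2 ≤ s.re) : ‖s‖ ≤ ‖s + 1‖ := by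
  rw [← sq_le_sq₀ (norm_nonneg _) (norm_nonneg _), ← normSq_eq_norm_sq, ← normSq_eq_norm_sq,
    normSq_apply, normSq_apply]
  simp
  nlinarith

theorem norm_inv_mul_add_one_le {s : ℂ} (hs : 1 / 2 ≤ s.re) :
    ‖(s * (s + 1))⁻¹‖ ≤ 9 * (1 + |s.im|) ^ (-2 : ℝ) := by
  have h1 := one_add_abs_im_le hs
  have h2 := norm_le_norm_add_one hs
  have h0 : 0 < 1 + |s.im| := by positivity
  rw [norm_inv, norm_mul, Real.rpow_neg h0.le, ← div_eq_mul_inv, le_div_iff₀ (by positivity),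
    inv_mul_le_iff₀ (by nlinarith)]
  norm_cast
  nlinarith

theorem ne_zero_of_half_le_re {s : ℂ} (hs : 1 / 2 ≤ s.re) : s ≠ 0 := by
  rintro rfl
  norm_num at hs

theorem add_one_ne_zero_of_half_le_re {s : ℂ} (hs : 1 / 2 ≤ s.re) : s + 1 ≠ 0 :=
  ne_zero_of_half_le_re (s := s + 1) (by simp; linarith)

/-- Mean value inequality: compared with the trivial estimate, a factor `N + 1` is saved at the cost
of `‖w‖`. -/
theorem norm_cpow_sub_cpow_le {N : ℝ} (hN : 1 ≤ N) {w : ℂ} (hw : 1 ≤ w.re) :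
    ‖((N + 1 : ℝ) : ℂ) ^ w - (N : ℂ) ^ w‖ ≤ ‖w‖ * (N + 1) ^ (w.re - 1) := by
  have hw0 : w ≠ 0 := by rintro rfl; norm_num at hw
  have h := (convex_Icc N (N + 1)).norm_image_sub_le_of_norm_hasDerivWithin_le
    (f := fun y : ℝ => (y : ℂ) ^ w) (f' := fun y => w * (y : ℂ) ^ (w - 1))
    (C := ‖w‖ * (N + 1) ^ (w.re - 1)) (x := N) (y := N + 1)
    (fun y hy => by
      have hy0 : y ≠ 0 := by have := hy.1; intro h; linarith
      exact (hasDerivAt_ofReal_cpow_const hy0 hw0).hasDerivWithinAt)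
    (fun y hy => by
      have hy0 : 0 < y := by linarith [hy.1]
      rw [norm_mul, norm_cpow_eq_rpow_re_of_pos hy0]
      have : (w - 1).re = w.re - 1 := by simp
      rw [this]
      gcongr
      exact hy.2)
    ⟨le_rfl, by linarith⟩ ⟨by linarith, le_rfl⟩
  simpa using h

/-- The Perron kernel for a sharp cutoff at the integer `N`. -/
noncomputable def perronKernel (N : ℕ) (s : ℂ) : ℂ :=
  (((N + 1 : ℝ) : ℂ) ^ (s + 1) - ((N : ℝ) : ℂ) ^ (s + 1)) / (s * (s + 1))

/-- Two bounds on the numerator are interpolated. The trivial one gives integrable decay `|s| ^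
(-2)` but loses a factor `N`; the mean value one has the right power of `N` but decay only `|s| ^
(-1)`. Weights `θ` and `1 - θ` keep integrability at a loss of `N ^ θ`. -/
theorem norm_perronKernel_le {N : ℕ} (hN : 1 ≤ N) {θ : ℝ} (hθ0 : 0 < θ) (hθ1 : θ < 1) {s : ℂ}
    (hs : 1 / 2 ≤ s.re) :
    ‖perronKernel N s‖ ≤ 18 * (N + 1 : ℝ) ^ (s.re + θ) * (1 + |s.im|) ^ (-(1 + θ)) := by
  have hN' : (1 : ℝ) ≤ N := by exact_mod_cast hN
  set X : ℝ := N + 1 with hX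
  have hX0 : 0 < X := by linarith
  have hs0 := norm_pos_iff.2 (ne_zero_of_half_le_re hs)
  have hs1 := norm_pos_iff.2 (add_one_ne_zero_of_half_le_re hs)
  set D := ‖(X : ℂ) ^ (s + 1) - ((N : ℝ) : ℂ) ^ (s + 1)‖ with hD
  have hD0 : 0 ≤ D := norm_nonneg _
  have hA : D ≤ 2 * X ^ (s.re + 1) := by
    refine (norm_sub_le _ _).trans ?_
    rw [norm_cpow_eq_rpow_re_of_pos hX0, norm_cpow_eq_rpow_re_of_pos (by linarith)]
    have : (s + 1).re = s.re + 1 := by simp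
    rw [this]
    have : (N : ℝ) ^ (s.re + 1) ≤ X ^ (s.re + 1) :=
      Real.rpow_le_rpow (by linarith) (by linarith) (by linarith)
    linarith
  have hB : D ≤ ‖s + 1‖ * X ^ s.re := by
    have := norm_cpow_sub_cpow_le hN' (w := s + 1) (by simp; linarith)
    simpa only [add_re, one_re, add_sub_cancel_right] using this
  have hmain : D ≤ 2 * X ^ (s.re + θ) * ‖s + 1‖ ^ (1 - θ) := by
    calc D = D ^ θ * D ^ (1 - θ) := by
          rcases hD0.eq_or_lt with h | h
          · rw [← h, Real.zero_rpow hθ0.ne', zero_mul]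
          · rw [← Real.rpow_add h]; simp
      _ ≤ (2 * X ^ (s.re + 1)) ^ θ * (‖s + 1‖ * X ^ s.re) ^ (1 - θ) := by
          gcongr
      _ = 2 ^ θ * X ^ (s.re + θ) * ‖s + 1‖ ^ (1 - θ) := by
          rw [Real.mul_rpow (by positivity) (by positivity),
            Real.mul_rpow (by positivity) (by positivity), ← Real.rpow_mul hX0.le,
            ← Real.rpow_mul hX0.le]
          have : X ^ (s.re + θ) = X ^ ((s.re + 1) * θ) * X ^ (s.re * (1 - θ)) := by
            rw [← Real.rpow_add hX0]; ring_nf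
          rw [this]; ring
      _ ≤ 2 * X ^ (s.re + θ) * ‖s + 1‖ ^ (1 - θ) := by
          gcongr
          calc (2 : ℝ) ^ θ ≤ 2 ^ (1 : ℝ) :=
                Real.rpow_le_rpow_of_exponent_le (by norm_num) hθ1.le
            _ = 2 := by simp
  rw [perronKernel, norm_div, norm_mul, div_le_iff₀ (by positivity)]
  refine hmain.trans ?_
  have h0 : 0 < 1 + |s.im| := by positivity
  have h3 : (1 + |s.im|) ^ (1 + θ) ≤ 9 * (‖s‖ * ‖s + 1‖ ^ θ) := by
    calc (1 + |s.im|) ^ (1 + θ) ≤ (3 * ‖s‖) ^ (1 + θ) := by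
          gcongr; exact one_add_abs_im_le hs
      _ = 3 ^ (1 + θ) * (‖s‖ * ‖s‖ ^ θ) := by
          rw [Real.mul_rpow (by norm_num) hs0.le, Real.rpow_add hs0, Real.rpow_one]
      _ ≤ 3 ^ (2 : ℝ) * (‖s‖ * ‖s + 1‖ ^ θ) := by
          gcongr
          · norm_num
          · linarith
          · exact norm_le_norm_add_one hs
      _ = _ := by norm_num
  rw [Real.rpow_neg h0.le]
  have h4 : ‖s + 1‖ = ‖s + 1‖ ^ θ * ‖s + 1‖ ^ (1 - θ) := by
    rw [← Real.rpow_add hs1]; simp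
  have h5 : 1 ≤ ((1 + |s.im|) ^ (1 + θ))⁻¹ * (9 * (‖s‖ * ‖s + 1‖ ^ θ)) := by
    rw [le_inv_mul_iff₀ (by positivity)]; linarith
  calc 2 * X ^ (s.re + θ) * ‖s + 1‖ ^ (1 - θ)
      ≤ 2 * X ^ (s.re + θ) * ‖s + 1‖ ^ (1 - θ) *
        (((1 + |s.im|) ^ (1 + θ))⁻¹ * (9 * (‖s‖ * ‖s + 1‖ ^ θ))) :=
        le_mul_of_one_le_right (by positivity) h5
    _ = 18 * X ^ (s.re + θ) * ((1 + |s.im|) ^ (1 + θ))⁻¹ *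
        (‖s‖ * (‖s + 1‖ ^ θ * ‖s + 1‖ ^ (1 - θ))) := by ring
    _ = _ := by rw [← h4]

theorem differentiableAt_perronKernel {N : ℕ} (hN : 1 ≤ N) {s : ℂ} (hs : 1 / 2 ≤ s.re) :
    DifferentiableAt ℂ (perronKernel N) s := by
  have h1 : ((N : ℝ) : ℂ) ≠ 0 := by
    have : N ≠ 0 := by lia
    exact_mod_cast this
  have h2 : ((N + 1 : ℝ) : ℂ) ≠ 0 := by
    have : N + 1 ≠ 0 := by lia
    exact_mod_cast this
  unfold perronKernel
  refine DifferentiableAt.div (DifferentiableAt.sub ?_ ?_) (by fun_prop)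
    (mul_ne_zero (ne_zero_of_half_le_re hs) (add_one_ne_zero_of_half_le_re hs))
  · exact DifferentiableAt.const_cpow (by fun_prop) (Or.inl h2)
  · exact DifferentiableAt.const_cpow (by fun_prop) (Or.inl h1)

/-- The Mellin transform of `u ↦ max 0 (1 - u)`. -/
theorem hasMellin_max_zero_one_sub {s : ℂ} (hs : 0 < s.re) :
    HasMellin (fun u : ℝ => ((max 0 (1 - u) : ℝ) : ℂ)) s (s * (s + 1))⁻¹ := by
  have h1 := hasMellin_one_Ioc hs
  have h2 := hasMellin_cpow_Ioc 1 (s := s) (by simp; linarith)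
  have h := hasMellin_sub h1.1 h2.1
  rw [h1.2, h2.2] at h
  have hs0 : s ≠ 0 := by rintro rfl; simp at hs
  have hs1 : s + 1 ≠ 0 := by
    intro h0; have := congrArg re h0; simp at this; linarith
  have heq : EqOn (fun t : ℝ => indicator (Ioc 0 1) (fun _ => 1 : ℝ → ℂ) t -
      indicator (Ioc 0 1) (fun t => (t : ℂ) ^ (1 : ℂ) : ℝ → ℂ) t)
      (fun u : ℝ => ((max 0 (1 - u) : ℝ) : ℂ)) (Ioi 0) := by
    intro t ht
    by_cases h : t ≤ 1
    · have : t ∈ Ioc (0 : ℝ) 1 := ⟨ht, h⟩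
      simp only [indicator_of_mem this, cpow_one]
      rw [max_eq_right (by linarith)]
      push_cast; rfl
    · have : t ∉ Ioc (0 : ℝ) 1 := fun h' => h h'.2
      simp only [indicator_of_notMem this]
      rw [max_eq_left (by linarith)]
      simp
  refine ⟨?_, ?_⟩
  · refine IntegrableOn.congr_fun h.1 (fun t ht => ?_) measurableSet_Ioi
    simp only [← heq ht]
  · have : mellin (fun u : ℝ => ((max 0 (1 - u) : ℝ) : ℂ)) s = 1 / s - 1 / (s + 1) := by
      rw [← h.2]
      refine setIntegral_congr_fun measurableSet_Ioi fun t ht => ?_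
      simp only [← heq ht]
    rw [this]
    field_simp
    ring

theorem integrable_inv_mul_add_one {σ : ℝ} (hσ : 1 / 2 ≤ σ) :
    Integrable fun t : ℝ => (((σ + t * I : ℂ)) * (σ + t * I + 1))⁻¹ := by
  refine integrable_vertical_line (H := fun s => (s * (s + 1))⁻¹) (C := 9) (β := 2) (by norm_num)
    ?_ fun t => ?_
  · refine Continuous.inv₀ (by fun_prop) fun t => ?_
    exact mul_ne_zero (ne_zero_of_half_le_re (by simpa using hσ))
      (add_one_ne_zero_of_half_le_re (by simpa using hσ))
  · simpa using norm_inv_mul_add_one_le (s := σ + t * I) (by simpa using hσ)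

/-- Mellin inversion applies because the cutoff is continuous and its transform decays quadratically
along vertical lines; a sharp cutoff would have neither property. -/
theorem mellinInv_max_zero_one_sub {σ u : ℝ} (hσ : 1 / 2 ≤ σ) (hu : 0 < u) :
    ((max 0 (1 - u) : ℝ) : ℂ) = (1 / (2 * Real.pi)) •
      ∫ t : ℝ, (u : ℂ) ^ (-(σ + t * I : ℂ)) * (((σ + t * I : ℂ)) * (σ + t * I + 1))⁻¹ := by
  set f : ℝ → ℂ := fun u : ℝ => ((max 0 (1 - u) : ℝ) : ℂ) with hf
  have hm : ∀ t : ℝ, mellin f (σ + t * I) = (((σ + t * I : ℂ)) * (σ + t * I + 1))⁻¹ := fun t =>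
    (hasMellin_max_zero_one_sub (by simp; linarith)).2
  have h := mellinInv_mellin_eq σ f hu
    (hasMellin_max_zero_one_sub (by simp; linarith)).1
    (by
      rw [VerticalIntegrable]
      simp_rw [hm]
      exact integrable_inv_mul_add_one hσ)
    (by simp only [f]; fun_prop)
  rw [mellinInv] at h
  simp_rw [hm, smul_eq_mul] at h
  exact h.symm

end

/-! ### Perron's formula and square-root cancellation from a continuation -/

section

open Complex Metric Set Filter Topology MeasureTheory

theorem norm_LSeries_term_le {a : ℕ → ℂ} (ha : ∀ n, ‖a n‖ ≤ 1) (s : ℂ) (n : ℕ) :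
    ‖LSeries.term a s n‖ ≤ 1 / (n : ℝ) ^ s.re := by
  rw [LSeries.norm_term_eq]
  split_ifs with h
  · positivity
  · gcongr
    exact ha n

theorem cpow_neg_div_eq {u x : ℝ} (hu : 0 < u) (hx : 0 < x) (s : ℂ) :
    ((u / x : ℝ) : ℂ) ^ (-s) = (x : ℂ) ^ s / (u : ℂ) ^ s := by
  have h : ((u / x : ℝ) : ℂ) ^ (-s) * (x : ℂ) ^ (-s) = (u : ℂ) ^ (-s) := by
    rw [← mul_cpow_ofReal_nonneg (by positivity) hx.le, ← ofReal_mul, div_mul_cancel₀ _ hx.ne']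
  have hx0 : (x : ℂ) ^ s ≠ 0 := by simp [cpow_eq_zero_iff, hx.ne']
  have hu0 : (u : ℂ) ^ s ≠ 0 := by simp [cpow_eq_zero_iff, hu.ne']
  rw [cpow_neg (x : ℂ), cpow_neg (u : ℂ)] at h
  field_simp at h ⊢
  linear_combination h

/-- The integrand in the smoothed Perron formula. -/
noncomputable def rieszKernel (x : ℝ) (s : ℂ) : ℂ := (x : ℂ) ^ (s + 1) * (s * (s + 1))⁻¹

theorem norm_rieszKernel_le {x : ℝ} (hx : 0 < x) {s : ℂ} (hs : 1 / 2 ≤ s.re) :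
    ‖rieszKernel x s‖ ≤ x ^ (s.re + 1) * 9 * (1 + |s.im|) ^ (-2 : ℝ) := by
  rw [rieszKernel, norm_mul, norm_cpow_eq_rpow_re_of_pos hx, mul_assoc, add_re, one_re]
  gcongr
  exact norm_inv_mul_add_one_le hs

theorem differentiableAt_rieszKernel {x : ℝ} (hx : 0 < x) {s : ℂ} (hs : 1 / 2 ≤ s.re) :
    DifferentiableAt ℂ (rieszKernel x) s := by
  unfold rieszKernel
  refine DifferentiableAt.mul ?_ (DifferentiableAt.inv (by fun_prop)
    (mul_ne_zero (ne_zero_of_half_le_re hs) (add_one_ne_zero_of_half_le_re hs)))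
  exact DifferentiableAt.const_cpow (by fun_prop) (Or.inl (ofReal_ne_zero.2 hx.ne'))

theorem continuous_vertical_line {H : ℂ → ℂ} {σ : ℝ}
    (h : ∀ s : ℂ, s.re = σ → DifferentiableAt ℂ H s) : Continuous fun t : ℝ => H (σ + t * I) := by
  refine continuous_iff_continuousAt.2 fun t => ?_
  exact ContinuousAt.comp (f := fun t : ℝ => (σ + t * I : ℂ)) (h _ (by simp)).continuousAt
    (by fun_prop)

theorem differentiableAt_LSeries_term (a : ℕ → ℂ) (s : ℂ) (n : ℕ) :
    DifferentiableAt ℂ (fun s => LSeries.term a s n) s := by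
  rcases eq_or_ne n 0 with rfl | hn
  · simp
  · have hn' : (n : ℂ) ≠ 0 := Nat.cast_ne_zero.2 hn
    simp only [LSeries.term_of_ne_zero hn]
    refine DifferentiableAt.div (by fun_prop) (DifferentiableAt.const_cpow (by fun_prop)
      (Or.inl hn')) ?_
    simp [cpow_eq_zero_iff, hn']

theorem integral_term_mul_rieszKernel (a : ℕ → ℂ) {x σ : ℝ} (hx : 0 < x) (hσ : 1 / 2 ≤ σ)
    (n : ℕ) :
    (1 / (2 * Real.pi)) • ∫ t : ℝ, LSeries.term a (σ + t * I) n * rieszKernel x (σ + t * I) =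
      if n = 0 then 0 else a n * ((max 0 (x - n) : ℝ) : ℂ) := by
  split_ifs with hn
  · simp [hn]
  have hn0 : (0 : ℝ) < n := by positivity
  have hmax : max 0 (x - n) = x * max 0 (1 - n / x) := by
    rw [mul_max_of_nonneg _ _ hx.le]
    congr 1
    · ring
    · field_simp
  rw [hmax, ofReal_mul, mellinInv_max_zero_one_sub hσ (div_pos hn0 hx), mul_smul_comm,
    mul_smul_comm, ← integral_const_mul, ← integral_const_mul]
  congr 2
  ext t
  rw [LSeries.term_of_ne_zero hn, rieszKernel, cpow_neg_div_eq hn0 hx,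
    cpow_add _ _ (ofReal_ne_zero.2 hx.ne'), cpow_one, ofReal_natCast]
  ring

/-- Perron's formula for Riesz means. -/
theorem hasSum_riesz_mean {a : ℕ → ℂ} (ha : ∀ n, ‖a n‖ ≤ 1) {x : ℝ} (hx : 0 < x) :
    HasSum (fun n : ℕ => if n = 0 then 0 else a n * ((max 0 (x - n) : ℝ) : ℂ))
      ((1 / (2 * Real.pi)) • ∫ t : ℝ, LSeries a ((2 : ℝ) + t * I) *
        rieszKernel x ((2 : ℝ) + t * I)) := by
  have hb : ∀ (n : ℕ) (t : ℝ), ‖LSeries.term a ((2 : ℝ) + t * I) n *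
      rieszKernel x ((2 : ℝ) + t * I)‖ ≤
      (1 / (n : ℝ) ^ (2 : ℝ)) * (x ^ (3 : ℝ) * 9) * (1 + |t|) ^ (-2 : ℝ) := by
    intro n t
    rw [norm_mul, mul_assoc]
    have h1 := norm_LSeries_term_le ha ((2 : ℝ) + t * I) n
    have h2 := norm_rieszKernel_le hx (s := (2 : ℝ) + t * I) (by simp; norm_num)
    simp only [add_re, ofReal_re, mul_re, I_re, mul_zero, ofReal_im, I_im, mul_one, sub_self,
      add_zero, add_im, mul_im, zero_add] at h1 h2
    norm_num at h1 h2 ⊢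
    gcongr
  have hint : ∀ n : ℕ, Integrable fun t : ℝ => LSeries.term a ((2 : ℝ) + t * I) n *
      rieszKernel x ((2 : ℝ) + t * I) := by
    intro n
    refine integrable_vertical_line (H := fun s => LSeries.term a s n * rieszKernel x s)
      (β := 2) (by norm_num) ?_ (hb n)
    refine continuous_vertical_line (H := fun s => LSeries.term a s n * rieszKernel x s)
      fun s hs => ?_
    exact (differentiableAt_LSeries_term a s n).mul
      (differentiableAt_rieszKernel hx (by rw [hs]; norm_num))
  have hsum : Summable fun n : ℕ => ∫ t : ℝ, ‖LSeries.term a ((2 : ℝ) + t * I) n *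
      rieszKernel x ((2 : ℝ) + t * I)‖ := by
    refine Summable.of_nonneg_of_le (fun n => integral_nonneg fun t => norm_nonneg _)
      (fun n => integral_mono (hint n).norm
        ((integrable_one_add_abs_rpow_neg (by norm_num : (1 : ℝ) < 2)).const_mul _) (hb n)) ?_
    simp_rw [integral_const_mul]
    exact ((Real.summable_one_div_nat_rpow.2 (by norm_num)).mul_right _).mul_right _
  have h := (hasSum_integral_of_summable_integral_norm hint hsum).const_smul (1 / (2 * Real.pi))
  simp_rw [integral_term_mul_rieszKernel a hx (by norm_num : (1 / 2 : ℝ) ≤ 2), tsum_mul_right] at h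
  exact h

theorem integrable_LSeries_mul_rieszKernel {a : ℕ → ℂ} (ha : ∀ n, ‖a n‖ ≤ 1) {x : ℝ}
    (hx : 0 < x) : Integrable fun t : ℝ => LSeries a ((2 : ℝ) + t * I) *
        rieszKernel x ((2 : ℝ) + t * I) := by
  have habs : LSeries.abscissaOfAbsConv a ≤ 1 :=
    LSeries.abscissaOfAbsConv_le_of_le_const ⟨1, fun n _ => ha n⟩
  refine integrable_vertical_line (H := fun s => LSeries a s * rieszKernel x s)
    (C := (∑' n : ℕ, 1 / (n : ℝ) ^ (2 : ℝ)) * (x ^ (3 : ℝ) * 9)) (β := 2) (by norm_num) ?_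
    fun t => ?_
  · refine continuous_vertical_line (H := fun s => LSeries a s * rieszKernel x s) fun s hs => ?_
    refine DifferentiableAt.mul ?_ (differentiableAt_rieszKernel hx (by rw [hs]; norm_num))
    refine (LSeries_hasDerivAt (habs.trans_lt ?_)).differentiableAt
    rw [hs]
    exact_mod_cast one_lt_two
  · rw [norm_mul, mul_assoc]
    have h1 : ‖LSeries a ((2 : ℝ) + t * I)‖ ≤ ∑' n : ℕ, 1 / (n : ℝ) ^ (2 : ℝ) := by
      refine tsum_of_norm_bounded
        (Real.summable_one_div_nat_rpow.2 (by norm_num : (1 : ℝ) < 2)).hasSum fun n => ?_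
      simpa using norm_LSeries_term_le ha ((2 : ℝ) + t * I) n
    have h2 := norm_rieszKernel_le hx (s := (2 : ℝ) + t * I) (by simp; norm_num)
    simp only [add_re, ofReal_re, mul_re, I_re, mul_zero, ofReal_im, I_im, mul_one, sub_self,
      add_zero, add_im, mul_im, zero_add] at h2
    norm_num at h1 h2 ⊢
    gcongr

/-- Perron's formula for the sharp cutoff at an integer, with an absolutely convergent integral. -/
theorem sum_Icc_eq_integral_perronKernel {a : ℕ → ℂ} (ha : ∀ n, ‖a n‖ ≤ 1) {N : ℕ} (hN : 1 ≤ N) :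
    ∑ n ∈ Finset.Icc 1 N, a n = (1 / (2 * Real.pi)) • ∫ t : ℝ, LSeries a ((2 : ℝ) + t * I) *
      perronKernel N ((2 : ℝ) + t * I) := by
  have hN0 : (0 : ℝ) < N := by exact_mod_cast hN
  have h := (hasSum_riesz_mean ha (by linarith : (0 : ℝ) < N + 1)).sub (hasSum_riesz_mean ha hN0)
  rw [← smul_sub, ← integral_sub (integrable_LSeries_mul_rieszKernel ha (by linarith))
    (integrable_LSeries_mul_rieszKernel ha hN0)] at h
  have hK : ∀ s : ℂ, LSeries a s * rieszKernel (N + 1) s - LSeries a s * rieszKernel N s =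
      LSeries a s * perronKernel N s := by
    intro s
    simp only [rieszKernel, perronKernel, div_eq_mul_inv]
    ring
  simp_rw [hK] at h
  refine HasSum.unique ?_ h
  -- The Riesz weights at `N + 1` and at `N` differ by exactly `1` for `n ≤ N` and both vanish for
  -- `n ≥ N + 1`, so their difference is the sharp cutoff.
  set F : ℕ → ℂ := fun n => (if n = 0 then 0 else a n * ((max 0 ((N : ℝ) + 1 - n) : ℝ) : ℂ)) -
      if n = 0 then 0 else a n * ((max 0 ((N : ℝ) - n) : ℝ) : ℂ) with hF
  have h2 : HasSum F (∑ n ∈ Finset.Icc 1 N, F n) := hasSum_sum_of_ne_finset_zero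
    (fun n hn => by
      rcases Nat.eq_zero_or_pos n with rfl | h0
      · simp [F]
      have : N + 1 ≤ n := by
        by_contra hlt
        exact hn (Finset.mem_Icc.2 ⟨h0, by lia⟩)
      have h' : (N : ℝ) + 1 ≤ n := by exact_mod_cast this
      simp only [F]
      rw [max_eq_left (by linarith), max_eq_left (by linarith)]
      simp)
  suffices hs : ∑ n ∈ Finset.Icc 1 N, a n = ∑ n ∈ Finset.Icc 1 N, F n from hs ▸ h2
  refine Finset.sum_congr rfl fun n hn => ?_
  have hn' := Finset.mem_Icc.1 hn
  have h1 : (n : ℝ) ≤ N := by exact_mod_cast hn'.2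
  simp only [F]
  rw [if_neg (by lia), if_neg (by lia), max_eq_right (by linarith), max_eq_right (by linarith)]
  push_cast
  ring

/-- Square-root cancellation from a holomorphic continuation to `1 / 2 < re s` of subpolynomial
growth. -/
theorem exists_norm_sum_Icc_le_of_continuation {a : ℕ → ℂ} (ha : ∀ n, ‖a n‖ ≤ 1) {D : ℂ → ℂ}
    (hD : ∀ s : ℂ, 1 / 2 < s.re → DifferentiableAt ℂ D s)
    (hDa : ∀ s : ℂ, 1 < s.re → D s = LSeries a s)
    (hgrowth : ∀ δ ε : ℝ, 0 < δ → 0 < ε → ∃ C : ℝ, ∀ s : ℂ, 1 / 2 + δ ≤ s.re → s.re ≤ 2 →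
      ‖D s‖ ≤ C * (1 + |s.im|) ^ ε) {ε : ℝ} (hε : 0 < ε) :
    ∃ C : ℝ, 0 ≤ C ∧ ∀ N : ℕ, 1 ≤ N → ‖∑ n ∈ Finset.Icc 1 N, a n‖ ≤ C * (N : ℝ) ^ (1 / 2 + ε) := by
  -- On the line `re s = 1/2 + θ` the kernel costs another `N ^ θ`, within `N ^ (1/2 + ε)` as `2 * θ
  -- ≤ ε`. Growth `θ / 2` of `D` against kernel decay `1 + θ` leaves the integrable exponent `1 + θ
  -- / 2`.
  set θ : ℝ := min ε 1 / 2 with hθ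
  have hθ0 : 0 < θ := by positivity
  have hθ1 : θ ≤ 1 / 2 := by
    have := min_le_right ε 1
    simp only [θ]; linarith
  have hθε : 2 * θ ≤ ε := by
    have := min_le_left ε 1
    simp only [θ]; linarith
  obtain ⟨C, hC⟩ := hgrowth θ (θ / 2) hθ0 (by linarith)
  have hC0 : 0 ≤ C := by
    have := (norm_nonneg _).trans (hC 2 (by simp; linarith) (by simp))
    simpa using this
  have hβ : 1 < 1 + θ / 2 := by linarith
  set J : ℝ := ∫ t : ℝ, (1 + |t|) ^ (-(1 + θ / 2)) with hJ
  have hJ0 : 0 ≤ J := integral_nonneg fun t => by positivity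
  refine ⟨(1 / (2 * Real.pi)) * (C * 18 * 2 ^ (1 / 2 + ε) * J), by positivity, fun N hN => ?_⟩
  have hN' : (1 : ℝ) ≤ N := by exact_mod_cast hN
  have hb : ∀ s : ℂ, 1 / 2 + θ ≤ s.re → s.re ≤ 2 → ‖D s * perronKernel N s‖ ≤
      C * 18 * (N + 1 : ℝ) ^ (s.re + θ) * (1 + |s.im|) ^ (-(1 + θ / 2)) := by
    intro s hs1 hs2
    have h1 := hC s hs1 hs2
    have h2 := norm_perronKernel_le hN hθ0 (by linarith) (s := s) (by linarith)
    rw [norm_mul]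
    have h0 : 0 < 1 + |s.im| := by positivity
    calc ‖D s‖ * ‖perronKernel N s‖ ≤ (C * (1 + |s.im|) ^ (θ / 2)) *
          (18 * (N + 1 : ℝ) ^ (s.re + θ) * (1 + |s.im|) ^ (-(1 + θ))) := by gcongr
      _ = C * 18 * (N + 1 : ℝ) ^ (s.re + θ) *
          ((1 + |s.im|) ^ (θ / 2) * (1 + |s.im|) ^ (-(1 + θ))) := by ring
      _ = _ := by rw [← Real.rpow_add h0]; ring_nf
  have hshift := integral_vertical_line_eq (H := fun s => D s * perronKernel N s)
    (a := 1 / 2 + θ) (b := 2) (C := C * 18 * (N + 1 : ℝ) ^ (2 + θ)) (by linarith) hβ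
    (fun s hs => ((hD s (by linarith [hs.1])).mul (differentiableAt_perronKernel hN
      (by linarith [hs.1]))).differentiableWithinAt)
    (fun s hs1 hs2 => (hb s hs1 hs2).trans (by gcongr; linarith))
  have hline : ∀ t : ℝ, LSeries a ((2 : ℝ) + t * I) = D ((2 : ℝ) + t * I) := fun t =>
    (hDa _ (by simp)).symm
  rw [sum_Icc_eq_integral_perronKernel ha hN]
  simp_rw [hline]
  rw [← hshift, norm_smul, Real.norm_of_nonneg (by positivity), mul_assoc (1 / (2 * Real.pi))]
  refine mul_le_mul_of_nonneg_left ?_ (by positivity)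
  have hbound := norm_integral_le_of_norm_le
    (f := fun t : ℝ => D ((1 / 2 + θ : ℝ) + t * I) * perronKernel N ((1 / 2 + θ : ℝ) + t * I))
    ((integrable_one_add_abs_rpow_neg hβ).const_mul
      (C * 18 * (N + 1 : ℝ) ^ (1 / 2 + θ + θ)))
    (Eventually.of_forall fun t : ℝ => by
      have h := hb ((1 / 2 + θ : ℝ) + t * I) (by simp) (by simp; linarith)
      rw [show (((1 / 2 + θ : ℝ) : ℂ) + t * I).re = 1 / 2 + θ by simp,
        show (((1 / 2 + θ : ℝ) : ℂ) + t * I).im = t by simp] at h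
      exact h)
  rw [integral_const_mul] at hbound
  refine hbound.trans ?_
  have hpow : (N + 1 : ℝ) ^ (1 / 2 + θ + θ) ≤ 2 ^ (1 / 2 + ε) * (N : ℝ) ^ (1 / 2 + ε) := by
    rw [← Real.mul_rpow (by norm_num) (by linarith)]
    calc (N + 1 : ℝ) ^ (1 / 2 + θ + θ) ≤ (N + 1 : ℝ) ^ (1 / 2 + ε) :=
          Real.rpow_le_rpow_of_exponent_le (by linarith) (by linarith)
      _ ≤ _ := by gcongr; linarith
  calc C * 18 * (N + 1 : ℝ) ^ (1 / 2 + θ + θ) * J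
      ≤ C * 18 * (2 ^ (1 / 2 + ε) * (N : ℝ) ^ (1 / 2 + ε)) * J := by gcongr
    _ = _ := by ring

end

/-! ### The reciprocal L-function and sums of χμ under GRH -/

section

open Complex Metric Set Filter Topology MeasureTheory

/-- A sublinear power is eventually below `ε * M`. With `M` essentially `log |t|`, this turns `exp
(C * M ^ θ)` into `O(|t| ^ ε)`. -/
theorem exists_mul_rpow_le_mul_add {θ C ε : ℝ} (hθ0 : 0 < θ) (hθ1 : θ < 1) (hC : 0 < C)
    (hε : 0 < ε) : ∃ C' : ℝ, ∀ M : ℝ, 1 ≤ M → C * M ^ θ ≤ ε * M + C' := by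
  refine ⟨C * ((C / ε) ^ (1 / (1 - θ))) ^ θ, fun M hM => ?_⟩
  have hM0 : 0 < M := by linarith
  have h1 : 0 < 1 - θ := by linarith
  rcases le_total (C / ε) (M ^ (1 - θ)) with h | h
  · have : C * M ^ θ ≤ ε * M := by
      rw [div_le_iff₀ hε] at h
      calc C * M ^ θ ≤ (M ^ (1 - θ) * ε) * M ^ θ := by gcongr
        _ = ε * (M ^ (1 - θ) * M ^ θ) := by ring
        _ = ε * M := by rw [← Real.rpow_add hM0]; simp
    have : 0 ≤ C * ((C / ε) ^ (1 / (1 - θ))) ^ θ := by positivity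
    linarith
  · have hMle : M ≤ (C / ε) ^ (1 / (1 - θ)) := by
      calc M = (M ^ (1 - θ)) ^ (1 / (1 - θ)) := by
            rw [← Real.rpow_mul hM0.le, mul_one_div_cancel h1.ne', Real.rpow_one]
        _ ≤ _ := by gcongr
    have : C * M ^ θ ≤ C * ((C / ε) ^ (1 / (1 - θ))) ^ θ := by gcongr
    have : 0 ≤ ε * M := by positivity
    linarith

theorem norm_LSeries_le_tsum {a : ℕ → ℂ} (ha : ∀ n, ‖a n‖ ≤ 1) {σ : ℝ} (hσ : 1 < σ) {s : ℂ}
    (hs : σ ≤ s.re) : ‖LSeries a s‖ ≤ ∑' n : ℕ, 1 / (n : ℝ) ^ σ := by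
  refine tsum_of_norm_bounded (Real.summable_one_div_nat_rpow.2 hσ).hasSum fun n => ?_
  refine (norm_LSeries_term_le ha s n).trans ?_
  rcases Nat.eq_zero_or_pos n with rfl | hn
  · rw [Nat.cast_zero, Real.zero_rpow (by linarith), Real.zero_rpow (by linarith)]
  · have : (1 : ℝ) ≤ n := by exact_mod_cast hn
    gcongr

theorem one_le_tsum_one_div_rpow {σ : ℝ} (hσ : 1 < σ) : 1 ≤ ∑' n : ℕ, 1 / (n : ℝ) ^ σ := by
  have := (Real.summable_one_div_nat_rpow.2 hσ).le_tsum 1 fun n _ => by positivity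
  simpa using this

namespace DirichletCharacter

open scoped ArithmeticFunction.Moebius

theorem norm_mul_moebius_le_one {q : ℕ} (χ : DirichletCharacter ℂ q) (n : ℕ) :
    ‖χ n * (μ n : ℂ)‖ ≤ 1 := by
  rw [norm_mul]
  refine mul_le_one₀ (χ.norm_le_one _) (norm_nonneg _) ?_
  rw [norm_intCast]
  exact_mod_cast ArithmeticFunction.abs_moebius_le_one

variable {q : ℕ} [NeZero q] (χ : DirichletCharacter ℂ q)

theorem inv_LFunction_eq_LSeries {s : ℂ} (hs : 1 < s.re) :
    (LFunction χ s)⁻¹ = LSeries (fun n : ℕ => χ n * (μ n : ℂ)) s := by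
  rw [LFunction_eq_LSeries χ hs]
  exact inv_eq_of_mul_eq_one_right (LSeries.mul_mu_eq_one χ hs)

/-- The Generalized Riemann Hypothesis implies the Lindelöf-type bound `1 / L(s, χ) ≪ |s| ^ ε` to
the right of the critical line. -/
theorem exists_norm_inv_LFunction_le (hGRH : GeneralizedRiemannHypothesis) {δ ε : ℝ} (hδ : 0 < δ)
    (hε : 0 < ε) : ∃ C : ℝ, ∀ s : ℂ, 1 / 2 + δ ≤ s.re → s.re ≤ 2 → 3 ≤ |s.im| →
      ‖(LFunction χ s)⁻¹‖ ≤ C * (1 + |s.im|) ^ ε := by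
  obtain ⟨C₁, hC₁, hL⟩ := exists_norm_LFunction_le χ
  set A₂ : ℝ := ∑' n : ℕ, 1 / (n : ℝ) ^ (2 : ℝ) with hA₂
  set A₃ : ℝ := ∑' n : ℕ, 1 / (n : ℝ) ^ (3 / 2 : ℝ) with hA₃
  have hA₂1 : 1 ≤ A₂ := one_le_tsum_one_div_rpow (by norm_num)
  have hA₃1 : 1 ≤ A₃ := one_le_tsum_one_div_rpow (by norm_num)
  -- The disc of radius `3/2` about `2 + it` touches the critical line; radius `r` reaches every `s`
  -- with `re s ≥ 1/2 + δ` at that height. The minimum keeps `r` at least the inner radius `1/2`,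
  -- whose disc lies in `re s > 3/2`, where the series converges absolutely.
  set r : ℝ := 3 / 2 - min δ 1 with hr
  have hr1 : 3 / 2 - δ ≤ r := by have := min_le_left δ 1; linarith
  have hr2 : 1 / 2 ≤ r := by have := min_le_right δ 1; linarith
  have hr3 : r < 3 / 2 := by have : 0 < min δ 1 := by positivity
                             linarith
  obtain ⟨θ, C, hθ0, hθ1, hC0, hC⟩ := norm_inv_le_exp_rpow_of_nonvanishing (ρ := 1 / 2)
    (B := A₃ * A₂) (by norm_num) hr2 hr3 (by positivity)
  obtain ⟨C', hC'⟩ := exists_mul_rpow_le_mul_add hθ0 hθ1 hC0 hε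
  refine ⟨Real.exp C' * (C₁ * A₂ * 4) ^ ε * A₂, fun s hs1 hs2 hs3 => ?_⟩
  set t : ℝ := s.im with ht
  set c : ℂ := 2 + t * I with hc
  have hcre : c.re = 2 := by simp [c]
  have hcim : c.im = t := by simp [c]
  have hne : ∀ w : ℂ, 1 / 2 < w.re → w.im ≠ 0 → LFunction χ w ≠ 0 := by
    intro w hw hwi h0
    have := hGRH q χ w (Or.inr fun h => hwi (by simp [h])) h0 (by linarith)
    linarith
  -- Height `|t| ≥ 3` keeps the whole disc away from the real axis, hence from the possible pole at
  -- `1`.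
  have hz : ∀ z ∈ ball (0 : ℂ) (3 / 2), 1 / 2 < (c + z).re ∧ 1 ≤ |(c + z).im| := by
    intro z hz
    rw [mem_ball_zero_iff] at hz
    have h1 := (abs_le.1 (abs_re_le_norm z)).1
    have h2 := abs_im_le_norm z
    rw [add_re, add_im, hcre, hcim]
    refine ⟨by linarith, ?_⟩
    have := abs_sub_abs_le_abs_sub t (-z.im)
    rw [sub_neg_eq_add, abs_neg] at this
    linarith
  have himne : ∀ w : ℂ, 1 ≤ |w.im| → w.im ≠ 0 := fun w hw h => by
    rw [h] at hw; norm_num at hw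
  have hLc : LFunction χ c ≠ 0 := by
    have := hz 0 (by simp)
    rw [add_zero] at this
    exact hne c this.1 (himne c this.2)
  have hLcinv : ‖(LFunction χ c)⁻¹‖ ≤ A₂ := by
    rw [inv_LFunction_eq_LSeries χ (by rw [hcre]; norm_num)]
    exact norm_LSeries_le_tsum (norm_mul_moebius_le_one χ) (by norm_num) hcre.ge
  set F : ℂ → ℂ := fun z => LFunction χ (c + z) * (LFunction χ c)⁻¹ with hF
  have hT : C₁ * A₂ * 4 ≤ C₁ * A₂ * (|t| + 4) := by gcongr; linarith [abs_nonneg t]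
  have hCA : 1 ≤ C₁ * A₂ := one_le_mul_of_one_le_of_one_le hC₁ hA₂1
  -- The summand `4` bounds `‖c + z‖ - |t|` and, since `4 > e`, also ensures `M ≥ 1`.
  set M : ℝ := Real.log (C₁ * A₂ * (|t| + 4)) with hM
  have hM1 : 1 ≤ M := by
    rw [hM, Real.le_log_iff_exp_le (by linarith)]
    linarith [Real.exp_one_lt_d9]
  have hsz : ‖s - c‖ ≤ r := by
    have : s - c = ((s.re - 2 : ℝ) : ℂ) := by
      apply Complex.ext
      · rw [sub_re, hcre, ofReal_re]
      · rw [sub_im, hcim, ofReal_im, sub_self]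
    rw [this, norm_real, Real.norm_eq_abs, abs_le]
    constructor <;> linarith
  have key := hC F M hM1
    (fun z hz' => by
      refine DifferentiableAt.differentiableWithinAt (DifferentiableAt.mul_const ?_ _)
      have hd : DifferentiableAt ℂ (LFunction χ) (c + z) :=
        differentiableAt_LFunction χ _ (Or.inl fun h => himne _ (hz z hz').2 (by rw [h, one_im]))
      exact hd.comp z (by fun_prop))
    (fun z hz' => mul_ne_zero (hne _ (hz z hz').1 (himne _ (hz z hz').2)) (inv_ne_zero hLc))
    (by simp [F, hLc])
    (fun z hz' => by
      rw [mem_ball_zero_iff] at hz'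
      have h1 := (abs_le.1 (abs_re_le_norm z)).1
      have h2 : 3 / 2 ≤ (c + z).re := by rw [add_re, hcre]; linarith
      simp only [F]
      rw [norm_mul, LFunction_eq_LSeries χ (by linarith)]
      calc _ ≤ A₃ * A₂ := by
            gcongr
            exact norm_LSeries_le_tsum (fun n => χ.norm_le_one _) (by norm_num) h2
        _ ≤ _ := by linarith [Real.add_one_le_exp (A₃ * A₂)])
    (fun z hz' => by
      have h1 := hL _ (hz z hz').1 (hz z hz').2
      rw [mem_ball_zero_iff] at hz'
      rw [hM, Real.exp_log (by linarith)]
      simp only [F]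
      rw [norm_mul]
      have h2 : ‖c + z‖ ≤ |t| + 4 := by
        calc ‖c + z‖ ≤ ‖c‖ + ‖z‖ := norm_add_le _ _
          _ ≤ (‖(2 : ℂ)‖ + ‖(t : ℂ) * I‖) + 3 / 2 := by gcongr; exact norm_add_le _ _
          _ = |t| + 7 / 2 := by simp; ring
          _ ≤ |t| + 4 := by linarith
      calc _ ≤ (C₁ * (|t| + 4)) * A₂ := by
            gcongr
            exact h1.trans (by gcongr)
        _ = _ := by ring)
    (s - c) hsz
  have hFs : F (s - c) = LFunction χ s * (LFunction χ c)⁻¹ := by simp [F]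
  have hinv : ‖(LFunction χ s)⁻¹‖ = ‖F (s - c)‖⁻¹ * ‖(LFunction χ c)⁻¹‖ := by
    have : LFunction χ s ≠ 0 := hne s (by linarith) (himne s (by linarith))
    rw [hFs, ← norm_inv, ← norm_mul]
    congr 1
    field_simp
  rw [hinv]
  have hexp : Real.exp (C * M ^ θ) ≤ Real.exp C' * (C₁ * A₂ * 4) ^ ε * (1 + |t|) ^ ε := by
    calc Real.exp (C * M ^ θ) ≤ Real.exp (ε * M + C') := Real.exp_le_exp.2 (hC' M hM1)
      _ = Real.exp C' * (C₁ * A₂ * (|t| + 4)) ^ ε := by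
          rw [Real.exp_add, mul_comm, Real.rpow_def_of_pos (by linarith), mul_comm ε]
      _ ≤ Real.exp C' * (C₁ * A₂ * 4 * (1 + |t|)) ^ ε := by
          rw [mul_assoc (C₁ * A₂)]
          gcongr
          linarith [abs_nonneg t]
      _ = _ := by rw [Real.mul_rpow (by linarith) (by positivity)]; ring
  calc _ ≤ (Real.exp C' * (C₁ * A₂ * 4) ^ ε * (1 + |t|) ^ ε) * A₂ := by
        gcongr
        exact key.trans hexp
    _ = _ := by ring

/-- The reciprocal of a Dirichlet `L`-function, with the zero at the pole of `L(s, χ)` for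
principal `χ`. -/
noncomputable def reciprocalLFunction (s : ℂ) : ℂ :=
  open Classical in
  if χ = 1 then (s - 1) / LFunctionTrivChar₁ q s else (LFunction χ s)⁻¹

theorem reciprocalLFunction_of_ne_one {s : ℂ} (hs : s ≠ 1) :
    reciprocalLFunction χ s = (LFunction χ s)⁻¹ := by
  rw [reciprocalLFunction]
  split_ifs with h
  · subst h
    rw [LFunctionTrivChar₁, Function.update_of_ne hs, LFunctionTrivChar, div_mul_eq_div_div,
      div_self (sub_ne_zero.2 hs), one_div]
  · rfl

/-- GRH excludes zeros to the right of the critical line. At `s = 1` with `χ` principal it says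
nothing, and the nonzero residue of `L(s, χ)` takes its place. -/
theorem differentiableAt_reciprocalLFunction (hGRH : GeneralizedRiemannHypothesis) {s : ℂ}
    (hs : 1 / 2 < s.re) : DifferentiableAt ℂ (reciprocalLFunction χ) s := by
  by_cases h : χ = 1
  · have heq : reciprocalLFunction χ = fun s => (s - 1) / LFunctionTrivChar₁ q s := by
      ext s; rw [reciprocalLFunction, if_pos h]
    rw [heq]
    refine DifferentiableAt.div (by fun_prop) (differentiable_LFunctionTrivChar₁ q s) ?_
    rcases eq_or_ne s 1 with rfl | hs1
    · exact LFunctionTrivChar₁_apply_one_ne_zero q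
    · rw [LFunctionTrivChar₁, Function.update_of_ne hs1]
      refine mul_ne_zero (sub_ne_zero.2 hs1) fun h0 => ?_
      have := hGRH q 1 s (Or.inr hs1) h0 (by linarith)
      linarith
  · have heq : reciprocalLFunction χ = fun s => (LFunction χ s)⁻¹ := by
      ext s; rw [reciprocalLFunction, if_neg h]
    rw [heq]
    refine (differentiable_LFunction h s).inv fun h0 => ?_
    have := hGRH q χ s (Or.inl h) h0 (by linarith)
    linarith

theorem exists_norm_reciprocalLFunction_le (hGRH : GeneralizedRiemannHypothesis) {δ ε : ℝ}
    (hδ : 0 < δ) (hε : 0 < ε) : ∃ C : ℝ, ∀ s : ℂ, 1 / 2 + δ ≤ s.re → s.re ≤ 2 →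
      ‖reciprocalLFunction χ s‖ ≤ C * (1 + |s.im|) ^ ε := by
  obtain ⟨C, hC⟩ := exists_norm_inv_LFunction_le χ hGRH hδ hε
  have hcomp : IsCompact (Icc (1 / 2 + δ) 2 ×ℂ Icc (-3) 3) := isCompact_Icc.reProdIm isCompact_Icc
  obtain ⟨C₀, hC₀⟩ := hcomp.exists_bound_of_continuousOn (f := reciprocalLFunction χ) fun s hs =>
    (differentiableAt_reciprocalLFunction χ hGRH
      (by linarith [hs.1.1])).continuousAt.continuousWithinAt
  refine ⟨max C C₀, fun s hs1 hs2 => ?_⟩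
  have h1 : 1 ≤ (1 + |s.im|) ^ ε := Real.one_le_rpow (by linarith [abs_nonneg s.im]) hε.le
  rcases le_total 3 |s.im| with h | h
  · rw [reciprocalLFunction_of_ne_one χ (by rintro rfl; norm_num at h)]
    refine (hC s hs1 hs2 h).trans ?_
    gcongr
    exact le_max_left _ _
  · have hb := hC₀ s ⟨⟨hs1, hs2⟩, abs_le.1 h⟩
    have h0 := (norm_nonneg _).trans hb
    calc _ ≤ C₀ * 1 := by linarith
      _ ≤ max C C₀ * (1 + |s.im|) ^ ε := by
        gcongr
        exact le_max_right _ _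

/-- Under the Generalized Riemann Hypothesis, the sums of `χ n * μ n` exhibit square-root
cancellation. -/
theorem exists_norm_sum_mul_moebius_le (hGRH : GeneralizedRiemannHypothesis) {ε : ℝ}
    (hε : 0 < ε) : ∃ C : ℝ, 0 ≤ C ∧ ∀ N : ℕ, 1 ≤ N →
      ‖∑ n ∈ Finset.Icc 1 N, χ n * (μ n : ℂ)‖ ≤ C * (N : ℝ) ^ (1 / 2 + ε) :=
  exists_norm_sum_Icc_le_of_continuation (norm_mul_moebius_le_one χ)
    (fun _ hs => differentiableAt_reciprocalLFunction χ hGRH hs)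
    (fun s hs => by
      rw [reciprocalLFunction_of_ne_one χ (by rintro rfl; simp at hs),
        inv_LFunction_eq_LSeries χ hs])
    (fun _ _ hδ hε => exists_norm_reciprocalLFunction_le χ hGRH hδ hε) hε

end DirichletCharacter

end

/-! ### k-free integers, modified characters, and changes at finitely many primes -/

section

open Finset
open scoped ArithmeticFunction.Moebius

/-- With `e = Nat.floorRoot k n`, the condition `d ^ k ∣ n` means `d ∣ e`, so the sum is `∑ μ d`
over the divisors of `e`; and `n` is `k`-free exactly when `e = 1`. -/
theorem sum_moebius_filter_pow_dvd {k N n : ℕ} (hk : k ≠ 0) (hn : n ≠ 0) (hnN : n ≤ N)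
    [Decidable (IsKFree k n)] :
    ∑ d ∈ Icc 1 N with d ^ k ∣ n, μ d = if IsKFree k n then 1 else 0 := by
  have he : Nat.floorRoot k n ≠ 0 := Nat.floorRoot_ne_zero.2 ⟨hk, hn⟩
  have hset : (Icc 1 N).filter (fun d => d ^ k ∣ n) = (Nat.floorRoot k n).divisors := by
    ext d
    rw [mem_filter, mem_Icc, Nat.mem_divisors, Nat.pow_dvd_iff_dvd_floorRoot]
    constructor
    · exact fun h => ⟨h.2, he⟩
    · rintro ⟨h, -⟩
      have hdn : d ∣ n := (dvd_pow_self d hk).trans (Nat.pow_dvd_iff_dvd_floorRoot.2 h)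
      exact ⟨⟨Nat.pos_of_dvd_of_pos h (Nat.pos_of_ne_zero he),
        (Nat.le_of_dvd (Nat.pos_of_ne_zero hn) hdn).trans hnN⟩, h⟩
  rw [hset, ← ArithmeticFunction.coe_mul_zeta_apply, ArithmeticFunction.moebius_mul_coe_zeta,
    ArithmeticFunction.one_apply]
  refine if_congr ?_ rfl rfl
  rw [Nat.eq_one_iff_not_exists_prime_dvd]
  refine forall₂_congr fun p _ => ?_
  rw [Nat.pow_dvd_iff_dvd_floorRoot]

theorem isKFree_mul_iff {k m n : ℕ} (h : m.Coprime n) :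
    IsKFree k (m * n) ↔ IsKFree k m ∧ IsKFree k n := by
  refine ⟨fun H => ⟨fun p hp hd => H p hp (hd.mul_right n), fun p hp hd => H p hp (hd.mul_left m)⟩,
    fun H p hp hd => ?_⟩
  by_cases hpn : p ∣ n
  · have hpm : ¬ p ∣ m := fun hpm => hp.one_lt.ne' (Nat.eq_one_of_dvd_coprimes h hpm hpn)
    exact H.2 p hp (Nat.Coprime.dvd_of_dvd_mul_left
      (Nat.Coprime.pow_left k ((Nat.Prime.coprime_iff_not_dvd hp).2 hpm)) hd)
  · exact H.1 p hp (Nat.Coprime.dvd_of_dvd_mul_right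
      (Nat.Coprime.pow_left k ((Nat.Prime.coprime_iff_not_dvd hp).2 hpn)) hd)

section

variable {q : ℕ} (χ : DirichletCharacter ℤ q)

theorem modifiedCharacter_zero : modifiedCharacter χ 0 = 1 := by simp [modifiedCharacter]

theorem modifiedCharacter_one : modifiedCharacter χ 1 = 1 := by simp [modifiedCharacter]

theorem modifiedCharacter_mul {m n : ℕ} (hm : m ≠ 0) (hn : n ≠ 0) :
    modifiedCharacter χ (m * n) = modifiedCharacter χ m * modifiedCharacter χ n := by
  rw [modifiedCharacter, Nat.factorization_mul hm hn]
  exact Finsupp.prod_add_index' (by simp) fun _ _ _ => pow_add _ _ _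

theorem modifiedCharacter_pow {m : ℕ} (hm : m ≠ 0) (k : ℕ) :
    modifiedCharacter χ (m ^ k) = modifiedCharacter χ m ^ k := by
  induction k with
  | zero => simp [modifiedCharacter_one]
  | succ k ih => rw [pow_succ, modifiedCharacter_mul χ (pow_ne_zero k hm) hm, ih, pow_succ]

theorem modifiedCharacter_prime {p : ℕ} (hp : p.Prime) :
    modifiedCharacter χ p = if p ∣ q then 1 else χ (p : ZMod q) := by
  simp [modifiedCharacter, hp.factorization]

theorem modifiedCharacter_prime_eq_or {p : ℕ} (hp : p.Prime) :
    modifiedCharacter χ p = 1 ∨ modifiedCharacter χ p = -1 := by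
  rw [modifiedCharacter_prime χ hp]
  split_ifs with h
  · exact Or.inl rfl
  · refine Int.isUnit_iff.1 (IsUnit.map χ ?_)
    exact (ZMod.isUnit_iff_coprime p q).2 ((Nat.Prime.coprime_iff_not_dvd hp).2 h)

theorem modifiedCharacter_eq_or (n : ℕ) :
    modifiedCharacter χ n = 1 ∨ modifiedCharacter χ n = -1 := by
  induction n using Nat.recOnMul with
  | zero => exact Or.inl (modifiedCharacter_zero χ)
  | one => exact Or.inl (modifiedCharacter_one χ)
  | prime p hp => exact modifiedCharacter_prime_eq_or χ hp
  | mul a b ha hb =>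
    -- The value at `0` is the empty product `1`, so multiplicativity is available only for nonzero
    -- factors.
    rcases eq_or_ne a 0 with rfl | ha0
    · rw [zero_mul]; exact ha
    rcases eq_or_ne b 0 with rfl | hb0
    · rw [mul_zero]; exact hb
    rw [modifiedCharacter_mul χ ha0 hb0]
    rcases ha with ha | ha <;> rcases hb with hb | hb <;> simp [ha, hb]

theorem abs_modifiedCharacter (n : ℕ) : |modifiedCharacter χ n| = 1 := by
  rcases modifiedCharacter_eq_or χ n with h | h <;> simp [h]

theorem modifiedCharacter_of_mem_factoredNumbers [NeZero q] {a : ℕ}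
    (ha : a ∈ Nat.factoredNumbers q.primeFactors) : modifiedCharacter χ a = 1 := by
  rw [modifiedCharacter, Finsupp.prod]
  refine Finset.prod_eq_one fun p hp => ?_
  have := Nat.primeFactors_subset_of_mem_factoredNumbers ha (by simpa using hp)
  rw [if_pos (Nat.dvd_of_mem_primeFactors this), one_pow]

theorem modifiedCharacter_of_coprime {m : ℕ} (hm : m ≠ 0) (h : m.Coprime q) :
    modifiedCharacter χ m = χ (m : ZMod q) := by
  conv_rhs => rw [← Nat.prod_factorization_pow_eq_self hm]
  rw [modifiedCharacter, Finsupp.prod, Finsupp.prod, Nat.cast_prod, map_prod]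
  refine Finset.prod_congr rfl fun p hp => ?_
  have hp' : p ∈ m.primeFactors := by simpa using hp
  have hpq : ¬ p ∣ q := fun hd => (Nat.prime_of_mem_primeFactors hp').one_lt.ne'
    (Nat.eq_one_of_dvd_coprimes h (Nat.dvd_of_mem_primeFactors hp') hd)
  rw [if_neg hpq, Nat.cast_pow, map_pow]

theorem isKFreeSignFunction_kFreeModifiedCharacter {k : ℕ} (hk : 2 ≤ k) :
    IsKFreeSignFunction k (kFreeModifiedCharacter k χ) := by
  classical
  have hdef : ∀ n, kFreeModifiedCharacter k χ n =
      if IsKFree k n then modifiedCharacter χ n else 0 := fun n => by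
    simp only [kFreeModifiedCharacter, ArithmeticFunction.coe_mk]
  have h1 : IsKFree k 1 := fun p hp hd =>
    hp.one_lt.ne' (Nat.dvd_one.1 ((dvd_pow_self p (by lia)).trans hd))
  refine ⟨ArithmeticFunction.IsMultiplicative.iff_ne_zero.2 ⟨?_, ?_⟩, ?_, ?_, ?_⟩
  · rw [hdef, if_pos h1, modifiedCharacter_one]
  · intro m n hm hn hmn
    rw [hdef, hdef, hdef, modifiedCharacter_mul χ hm hn]
    simp only [isKFree_mul_iff hmn]
    split_ifs <;> simp_all
  · intro n
    rw [hdef]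
    split_ifs
    · rcases modifiedCharacter_eq_or χ n with h | h <;> simp [h]
    · simp
  · intro n hn
    rw [hdef, if_neg hn]
  · intro p hp
    rw [hdef, if_pos]
    · exact modifiedCharacter_eq_or χ p
    · intro r hr hd
      have h2 : r ^ 2 ∣ p := (pow_dvd_pow r hk).trans hd
      have hrp : r = p := (Nat.prime_dvd_prime_iff_eq hr hp).1 ((dvd_pow_self r two_ne_zero).trans h2)
      subst hrp
      have := Nat.le_of_dvd hr.pos h2
      nlinarith [hr.two_le]

end

theorem coprime_of_mem_factoredNumbers {q a m : ℕ} (ha : a ∈ Nat.factoredNumbers q.primeFactors)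
    (hm : m.Coprime q) : a.Coprime m := by
  refine Nat.coprime_of_dvd fun p hp hpa hpm => ?_
  have hpq : p ∈ q.primeFactors := Nat.primeFactors_subset_of_mem_factoredNumbers ha
    (Nat.mem_primeFactors.2 ⟨hp, hpa, Nat.ne_zero_of_mem_factoredNumbers ha⟩)
  exact hp.one_lt.ne' (Nat.eq_one_of_dvd_coprimes hm hpm (Nat.dvd_of_mem_primeFactors hpq))

theorem exists_eq_mul_factoredNumbers_coprime {q : ℕ} (hq : q ≠ 0) {n : ℕ} (hn : n ≠ 0) :
    ∃ a ∈ Nat.factoredNumbers q.primeFactors, ∃ m : ℕ, m.Coprime q ∧ n = a * m := by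
  induction n using Nat.strong_induction_on with
  | _ n ih =>
    by_cases h : n.Coprime q
    · exact ⟨1, by simp [Nat.mem_factoredNumbers], n, h, (one_mul n).symm⟩
    · obtain ⟨p, hp, hpn, hpq⟩ := Nat.Prime.not_coprime_iff_dvd.1 h
      obtain ⟨n', rfl⟩ := hpn
      have hn' : n' ≠ 0 := by rintro rfl; simp at hn
      obtain ⟨a, ha, m, hm, rfl⟩ := ih n' (by
        have := hp.two_le
        have := Nat.pos_of_ne_zero hn'
        nlinarith) hn'
      refine ⟨p * a, Nat.mul_mem_factoredNumbers ?_ ha, m, hm, by ring⟩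
      refine Nat.mem_factoredNumbers_of_primeFactors_subset hp.ne_zero ?_
      rw [hp.primeFactors, Finset.singleton_subset_iff]
      exact Nat.mem_primeFactors.2 ⟨hp, hpq, hq⟩

/-- A finite Euler product of convergent geometric series: with finitely many primes, any `η > 0`
suffices. -/
theorem summable_factoredNumbers_rpow_neg (s : Finset ℕ) {η : ℝ} (hη : 0 < η) :
    Summable fun a : Nat.factoredNumbers s => ((a : ℕ) : ℝ) ^ (-η) := by
  let f : ℕ →* ℝ :=
    { toFun := fun n => (n : ℝ) ^ (-η)
      map_one' := by simp
      map_mul' := fun m n => by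
        rw [Nat.cast_mul, Real.mul_rpow (Nat.cast_nonneg m) (Nat.cast_nonneg n)] }
  have hf : ∀ {p : ℕ}, p.Prime → ‖f p‖ < 1 := fun {p} hp => by
    have h1 : (1 : ℝ) < p := by exact_mod_cast hp.one_lt
    simp only [f, MonoidHom.coe_mk, OneHom.coe_mk]
    rw [Real.norm_of_nonneg (by positivity)]
    exact Real.rpow_lt_one_of_one_lt_of_neg h1 (by linarith)
  refine ((EulerProduct.summable_and_hasSum_factoredNumbers_prod_filter_prime_geometric
    hf s).1).congr fun a => ?_
  simp only [f, MonoidHom.coe_mk, OneHom.coe_mk]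
  rw [Real.norm_of_nonneg (by positivity)]

-- Each `n ≥ 1` is uniquely `a * m` with `a` composed of primes dividing `q` and `m` coprime to `q`;
-- the sum is regrouped by `a`.
open Classical in
theorem sum_Icc_eq_sum_factoredNumbers {q : ℕ} (hq : q ≠ 0) {A B F : ℕ → ℤ}
    (hF : ∀ a ∈ Nat.factoredNumbers q.primeFactors, ∀ m : ℕ, m ≠ 0 → m.Coprime q →
      F (a * m) = A a * B m)
    (hB : ∀ m : ℕ, ¬ m.Coprime q → B m = 0) (N : ℕ) :
    ∑ n ∈ Icc 1 N, F n = ∑ a ∈ Icc 1 N with a ∈ Nat.factoredNumbers q.primeFactors,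
      A a * ∑ m ∈ Icc 1 (N / a), B m := by
  have h1 : ∀ a, ∑ m ∈ Icc 1 (N / a), B m = ∑ m ∈ Icc 1 (N / a) with m.Coprime q, B m := by
    intro a
    rw [sum_filter_of_ne]
    intro m _ hm
    by_contra h
    exact hm (hB m h)
  simp_rw [h1, mul_sum]
  rw [sum_sigma']
  symm
  refine sum_nbij (fun x => x.1 * x.2) ?_ ?_ ?_ ?_
  · rintro ⟨a, m⟩ hx
    simp only [mem_sigma, mem_filter, mem_Icc] at hx ⊢
    exact ⟨Nat.mul_pos hx.1.1.1 hx.2.1.1, by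
      rw [mul_comm]; exact (Nat.le_div_iff_mul_le hx.1.1.1).1 hx.2.1.2⟩
  · rintro ⟨a, m⟩ hx ⟨a', m'⟩ hx' heq
    simp only [coe_sigma, Set.mem_sigma_iff, mem_coe, mem_filter, mem_Icc] at hx hx' heq
    have e1 : a ∣ a' := (coprime_of_mem_factoredNumbers hx.1.2 hx'.2.2).dvd_of_dvd_mul_right
      ⟨m, heq.symm⟩
    have e2 : a' ∣ a := (coprime_of_mem_factoredNumbers hx'.1.2 hx.2.2).dvd_of_dvd_mul_right
      ⟨m', heq⟩
    have e3 : a = a' := Nat.dvd_antisymm e1 e2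
    subst e3
    have e4 : m = m' := Nat.eq_of_mul_eq_mul_left hx.1.1.1 heq
    subst e4
    rfl
  · intro n hn
    have hn' := mem_Icc.1 (mem_coe.1 hn)
    obtain ⟨a, ha, m, hm, rfl⟩ := exists_eq_mul_factoredNumbers_coprime hq (n := n) (by lia)
    have ha0 := Nat.pos_of_ne_zero (Nat.ne_zero_of_mem_factoredNumbers ha)
    have hm0 : 0 < m := Nat.pos_of_ne_zero (by rintro rfl; simp at hn')
    refine ⟨⟨a, m⟩, ?_, rfl⟩
    simp only [coe_sigma, Set.mem_sigma_iff, mem_coe, mem_filter, mem_Icc]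
    exact ⟨⟨⟨ha0, (Nat.le_mul_of_pos_right a hm0).trans hn'.2⟩, ha⟩,
      ⟨hm0, (Nat.le_div_iff_mul_le ha0).2 (by rw [mul_comm]; exact hn'.2)⟩, hm⟩
  · rintro ⟨a, m⟩ hx
    simp only [mem_sigma, mem_filter, mem_Icc] at hx
    exact (hF a hx.1.2 m (by lia) hx.2.2).symm

/-- Bounds for partial sums survive the modification of a function at finitely many primes. -/
theorem exists_abs_sum_Icc_le_of_coprime {q : ℕ} (hq : q ≠ 0) {A B F : ℕ → ℤ}
    (hA : ∀ a, |A a| ≤ 1)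
    (hF : ∀ a ∈ Nat.factoredNumbers q.primeFactors, ∀ m : ℕ, m ≠ 0 → m.Coprime q →
      F (a * m) = A a * B m)
    (hB : ∀ m : ℕ, ¬ m.Coprime q → B m = 0) {C β η : ℝ} (hC : 0 ≤ C) (hβ : 0 ≤ β) (hη : 0 < η)
    (hsum : ∀ N : ℕ, 1 ≤ N → |((∑ n ∈ Icc 1 N, B n : ℤ) : ℝ)| ≤ C * (N : ℝ) ^ β) :
    ∃ C' : ℝ, 0 ≤ C' ∧ ∀ N : ℕ, 1 ≤ N →
      |((∑ n ∈ Icc 1 N, F n : ℤ) : ℝ)| ≤ C' * (N : ℝ) ^ (β + η) := by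
  classical
  have hs := summable_factoredNumbers_rpow_neg q.primeFactors hη
  set S := ∑' a : Nat.factoredNumbers q.primeFactors, ((a : ℕ) : ℝ) ^ (-η) with hS
  have hS0 : 0 ≤ S := tsum_nonneg fun a => by positivity
  refine ⟨C * S, by positivity, fun N hN => ?_⟩
  rw [sum_Icc_eq_sum_factoredNumbers hq hF hB]
  push_cast
  refine (abs_sum_le_sum_abs _ _).trans ?_
  have hterm : ∀ a ∈ (Icc 1 N).filter (· ∈ Nat.factoredNumbers q.primeFactors),
      |(A a : ℝ) * ∑ m ∈ Icc 1 (N / a), (B m : ℝ)| ≤ C * (N : ℝ) ^ (β + η) * (a : ℝ) ^ (-η) := by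
    intro a ha
    rw [mem_filter, mem_Icc] at ha
    have ha0 : (0 : ℝ) < a := by exact_mod_cast ha.1.1
    have ha1 : (1 : ℝ) ≤ a := by exact_mod_cast ha.1.1
    have hNa : (1 : ℝ) ≤ N / a := by
      rw [le_div_iff₀ ha0, one_mul]; exact_mod_cast ha.1.2
    have h1 := hsum (N / a) ((Nat.one_le_div_iff ha.1.1).2 ha.1.2)
    push_cast at h1
    have hA' : |(A a : ℝ)| ≤ 1 := by exact_mod_cast hA a
    rw [abs_mul]
    calc |(A a : ℝ)| * |∑ m ∈ Icc 1 (N / a), (B m : ℝ)|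
        ≤ 1 * (C * ((N / a : ℕ) : ℝ) ^ β) := by gcongr
      _ ≤ 1 * (C * ((N : ℝ) / a) ^ β) := by gcongr; exact Nat.cast_div_le
      -- The exponent is raised, as `N / a ≥ 1`, in order to gain the summable factor `a ^ (-η)`;
      -- when `β = 0` there would otherwise be no decay in `a`.
      _ ≤ C * ((N : ℝ) / a) ^ (β + η) := by
          rw [one_mul]
          have := Real.rpow_le_rpow_of_exponent_le hNa (by linarith : β ≤ β + η)
          gcongr
      _ = C * (N : ℝ) ^ (β + η) * (a : ℝ) ^ (-(β + η)) := by
          rw [Real.div_rpow (by positivity) ha0.le, Real.rpow_neg ha0.le]; ring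
      _ ≤ C * (N : ℝ) ^ (β + η) * (a : ℝ) ^ (-η) := by
          have := Real.rpow_le_rpow_of_exponent_le ha1 (by linarith : -(β + η) ≤ -η)
          gcongr
  refine (sum_le_sum hterm).trans ?_
  rw [← mul_sum]
  have hfin : ∑ a ∈ Icc 1 N with a ∈ Nat.factoredNumbers q.primeFactors, (a : ℝ) ^ (-η) ≤ S := by
    have := hs.sum_le_tsum ((Icc 1 N).subtype (· ∈ Nat.factoredNumbers q.primeFactors))
      fun a _ => by positivity
    rwa [sum_subtype_eq_sum_filter (f := fun a : ℕ => (a : ℝ) ^ (-η))] at this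
  calc _ ≤ C * (N : ℝ) ^ (β + η) * S := by gcongr
    _ = _ := by ring

end

/-! ### The hyperbola method and the final exponent -/

section

open Finset
open scoped ArithmeticFunction.Moebius

section

variable {q : ℕ} [NeZero q] (χ : DirichletCharacter ℤ q)

theorem exists_abs_sum_mul_moebius_le (hGRH : GeneralizedRiemannHypothesis) {ε : ℝ} (hε : 0 < ε) :
    ∃ C : ℝ, 0 ≤ C ∧ ∀ N : ℕ, 1 ≤ N →
      |((∑ n ∈ Icc 1 N, χ n * μ n : ℤ) : ℝ)| ≤ C * (N : ℝ) ^ (1 / 2 + ε) := by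
  obtain ⟨C, hC, h⟩ := DirichletCharacter.exists_norm_sum_mul_moebius_le
    (χ.ringHomComp (Int.castRingHom ℂ)) hGRH hε
  refine ⟨C, hC, fun N hN => ?_⟩
  have hcast : ∑ n ∈ Icc 1 N, χ.ringHomComp (Int.castRingHom ℂ) n * (μ n : ℂ) =
      ((∑ n ∈ Icc 1 N, χ n * μ n : ℤ) : ℂ) := by simp
  rw [← Complex.norm_intCast, ← hcast]
  exact h N hN

theorem exists_abs_sum_character_le (hχ : χ ≠ 1) :
    ∃ C : ℝ, 0 ≤ C ∧ ∀ N : ℕ, 1 ≤ N →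
      |((∑ n ∈ Icc 1 N, χ n : ℤ) : ℝ)| ≤ C * (N : ℝ) ^ (0 : ℝ) := by
  obtain ⟨K, hK, h⟩ := exists_norm_sum_Icc_sub_le (fun a => (χ a : ℂ))
  refine ⟨K, hK, fun N _ => ?_⟩
  have h0 : ∑ a, (χ a : ℂ) = 0 := by
    rw [← Int.cast_sum, MulChar.sum_eq_zero_of_ne_one hχ, Int.cast_zero]
  have := h N
  rw [h0, zero_div, zero_mul, sub_zero, ← Int.cast_sum, Complex.norm_intCast] at this
  simpa using this

theorem exists_abs_sum_modifiedCharacter_le (hχ : χ ≠ 1) {ε : ℝ} (hε : 0 < ε) :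
    ∃ C : ℝ, 0 ≤ C ∧ ∀ N : ℕ, 1 ≤ N →
      |((∑ n ∈ Icc 1 N, modifiedCharacter χ n : ℤ) : ℝ)| ≤ C * (N : ℝ) ^ ε := by
  obtain ⟨C, hC, h⟩ := exists_abs_sum_character_le χ hχ
  have := exists_abs_sum_Icc_le_of_coprime (NeZero.ne q) (A := fun _ => 1) (B := fun n => χ n)
    (F := modifiedCharacter χ) (by simp)
    (fun a ha m hm hmq => by
      rw [modifiedCharacter_mul χ (Nat.ne_zero_of_mem_factoredNumbers ha) hm,
        modifiedCharacter_of_mem_factoredNumbers χ ha, modifiedCharacter_of_coprime χ hm hmq])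
    (fun m hm => χ.map_nonunit fun hu => hm ((ZMod.isUnit_iff_coprime m q).1 hu))
    hC le_rfl hε h
  simpa using this

theorem exists_abs_sum_moebius_mul_modifiedCharacter_le (hGRH : GeneralizedRiemannHypothesis)
    {ε : ℝ} (hε : 0 < ε) :
    ∃ C : ℝ, 0 ≤ C ∧ ∀ N : ℕ, 1 ≤ N →
      |((∑ n ∈ Icc 1 N, μ n * modifiedCharacter χ n : ℤ) : ℝ)| ≤ C * (N : ℝ) ^ (1 / 2 + ε) := by
  obtain ⟨C, hC, h⟩ := exists_abs_sum_mul_moebius_le χ hGRH (half_pos hε)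
  have := exists_abs_sum_Icc_le_of_coprime (NeZero.ne q) (A := fun a => μ a)
    (B := fun n => χ n * μ n) (F := fun n => μ n * modifiedCharacter χ n)
    (fun a => ArithmeticFunction.abs_moebius_le_one)
    (fun a ha m hm hmq => by
      rw [modifiedCharacter_mul χ (Nat.ne_zero_of_mem_factoredNumbers ha) hm,
        modifiedCharacter_of_mem_factoredNumbers χ ha, modifiedCharacter_of_coprime χ hm hmq,
        ArithmeticFunction.isMultiplicative_moebius.map_mul_of_coprime
          (coprime_of_mem_factoredNumbers ha hmq)]
      ring)
    (fun m hm => by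
      rw [χ.map_nonunit fun hu => hm ((ZMod.isUnit_iff_coprime m q).1 hu), zero_mul])
    hC (by linarith) (half_pos hε) h
  rwa [add_assoc, add_halves] at this

/-- Only the parity of `k` matters, since the values are `±1`: even `k` leaves `μ`, treated as the
character modulo `1`, and odd `k` leaves the twist by the modified character. -/
theorem exists_abs_sum_moebius_mul_modifiedCharacter_pow_le (hGRH : GeneralizedRiemannHypothesis)
    (k : ℕ) {ε : ℝ} (hε : 0 < ε) :
    ∃ C : ℝ, 0 ≤ C ∧ ∀ N : ℕ, 1 ≤ N →
      |((∑ n ∈ Icc 1 N, μ n * modifiedCharacter χ n ^ k : ℤ) : ℝ)| ≤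
        C * (N : ℝ) ^ (1 / 2 + ε) := by
  rcases Nat.even_or_odd k with hk | hk
  · have hpow : ∀ n, modifiedCharacter χ n ^ k = 1 := fun n => by
      rcases modifiedCharacter_eq_or χ n with h | h <;> simp [h, hk.neg_pow]
    have h := exists_abs_sum_mul_moebius_le (1 : DirichletCharacter ℤ 1) hGRH hε
    have h1 : ∀ n : ℕ, (1 : DirichletCharacter ℤ 1) (n : ZMod 1) = 1 := fun n =>
      MulChar.one_apply (isUnit_of_subsingleton _)
    simpa only [hpow, h1, one_mul, mul_one] using h
  · have hpow : ∀ n, modifiedCharacter χ n ^ k = modifiedCharacter χ n := fun n => by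
      rcases modifiedCharacter_eq_or χ n with h | h <;> simp [h, hk.neg_pow]
    simpa only [hpow] using exists_abs_sum_moebius_mul_modifiedCharacter_le χ hGRH hε

end

theorem sum_Icc_filter_dvd {R : Type*} [AddCommMonoid R] (g : ℕ → R) {e : ℕ} (he : 0 < e)
    (N : ℕ) : ∑ n ∈ Icc 1 N with e ∣ n, g n = ∑ m ∈ Icc 1 (N / e), g (e * m) := by
  symm
  refine sum_nbij (e * ·) ?_ ?_ ?_ fun _ _ => rfl
  · intro m hm
    simp only [mem_filter, mem_Icc] at hm ⊢
    exact ⟨⟨Nat.mul_pos he hm.1, by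
      rw [mul_comm]; exact (Nat.le_div_iff_mul_le he).1 hm.2⟩, dvd_mul_right e m⟩
  · exact fun m _ m' _ h => Nat.eq_of_mul_eq_mul_left he h
  · intro n hn
    simp only [coe_filter, mem_Icc, Set.mem_ofPred_eq] at hn
    obtain ⟨⟨h1, h2⟩, m, rfl⟩ := hn
    refine ⟨m, ?_, rfl⟩
    rw [mem_coe, mem_Icc]
    exact ⟨Nat.pos_of_mul_pos_left h1, (Nat.le_div_iff_mul_le he).2 (by rw [mul_comm]; exact h2)⟩

theorem sum_kFreeModifiedCharacter {q : ℕ} (χ : DirichletCharacter ℤ q) {k : ℕ} (hk : k ≠ 0)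
    (N : ℕ) : ∑ n ∈ Icc 1 N, kFreeModifiedCharacter k χ n =
      ∑ d ∈ Icc 1 N, μ d * modifiedCharacter χ d ^ k *
        ∑ m ∈ Icc 1 (N / d ^ k), modifiedCharacter χ m := by
  classical
  have h1 : ∀ n ∈ Icc 1 N, kFreeModifiedCharacter k χ n =
      ∑ d ∈ Icc 1 N, if d ^ k ∣ n then μ d * modifiedCharacter χ n else 0 := by
    intro n hn
    have hn' := mem_Icc.1 hn
    have h := sum_moebius_filter_pow_dvd hk (n := n) (by lia) hn'.2
    rw [← sum_filter, ← sum_mul, h]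
    simp only [kFreeModifiedCharacter, ArithmeticFunction.coe_mk]
    split_ifs <;> simp
  rw [sum_congr rfl h1, sum_comm]
  refine sum_congr rfl fun d hd => ?_
  have hd0 : d ≠ 0 := by have := (mem_Icc.1 hd).1; lia
  rw [← sum_filter, sum_Icc_filter_dvd _ (pow_pos (Nat.pos_of_ne_zero hd0) k), mul_sum]
  refine sum_congr rfl fun m hm => ?_
  rw [modifiedCharacter_mul χ (pow_ne_zero k hd0) (by have := (mem_Icc.1 hm).1; lia),
    modifiedCharacter_pow χ hd0, mul_assoc]

/-- The tail of the hyperbola method: the inner sum over `d` in `∑ h d * g m`, `d ^ k * m ≤ N`,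
`d > Y`. -/
theorem abs_sum_Ioc_ite_le {h : ℕ → ℝ} {C β y : ℝ} {k N Y m : ℕ} (hk : k ≠ 0) (hm : 1 ≤ m)
    (hY : 1 ≤ Y) (hy : 0 < y) (hyY : y < Y + 1) (hC : 0 ≤ C) (hβ : 0 ≤ β)
    (hh : ∀ D : ℕ, 1 ≤ D → |∑ d ∈ Icc 1 D, h d| ≤ C * (D : ℝ) ^ (k * β)) :
    |∑ d ∈ Ioc Y N, if d ^ k * m ≤ N then h d else 0| ≤
      if (m : ℝ) ≤ N / y ^ k then 2 * C * ((N : ℝ) / m) ^ β else 0 := by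
  -- The condition `d ^ k * m ≤ N` cuts the range at `D`. If `D ≤ Y` nothing remains; otherwise `D ≥
  -- Y + 1 > y`, which forces `m ≤ N / y ^ k`, and the sum is a difference of two initial sums.
  set D := Nat.findGreatest (fun d => d ^ k * m ≤ N) N with hD
  have hD0 : D ^ k * m ≤ N :=
    Nat.findGreatest_spec (P := fun d => d ^ k * m ≤ N) (Nat.zero_le N) (by simp [hk])
  have hiff : ∀ d, d ≤ N → (d ^ k * m ≤ N ↔ d ≤ D) := fun d hd =>
    ⟨fun hd' => Nat.le_findGreatest hd hd', fun hd' =>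
      (Nat.mul_le_mul_right m (Nat.pow_le_pow_left hd' k)).trans hD0⟩
  have hDN : D ≤ N := Nat.findGreatest_le N
  have hsum : (∑ d ∈ Ioc Y N, if d ^ k * m ≤ N then h d else 0) = ∑ d ∈ Ioc Y D, h d := by
    rw [← sum_filter]
    refine sum_congr ?_ fun _ _ => rfl
    ext d
    simp only [mem_filter, mem_Ioc]
    constructor
    · rintro ⟨⟨h1, h2⟩, h3⟩
      exact ⟨h1, (hiff d h2).1 h3⟩
    · rintro ⟨h1, h2⟩
      exact ⟨⟨h1, h2.trans hDN⟩, (hiff d (h2.trans hDN)).2 h2⟩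
  rw [hsum]
  have hm0 : (0 : ℝ) < m := by exact_mod_cast hm
  rcases le_or_gt D Y with hDY | hDY
  · rw [Ioc_eq_empty (by lia), sum_empty, abs_zero]
    split_ifs <;> positivity
  · have hDr : (D : ℝ) ^ k * m ≤ N := by exact_mod_cast hD0
    have hyD : y ≤ D := by
      have : (Y : ℝ) + 1 ≤ D := by exact_mod_cast hDY
      linarith
    have hmle : (m : ℝ) ≤ N / y ^ k := by
      rw [le_div_iff₀ (by positivity), mul_comm]
      exact le_trans (by gcongr) hDr
    rw [if_pos hmle]
    have hsplit : ∑ d ∈ Ioc Y D, h d = ∑ d ∈ Icc 1 D, h d - ∑ d ∈ Icc 1 Y, h d := by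
      have hI : ∀ n, Icc 1 n = Ioc 0 n := fun n => by ext; simp [Nat.lt_iff_add_one_le]
      rw [hI, hI, ← sum_Ioc_consecutive h (Nat.zero_le Y) hDY.le, add_sub_cancel_left]
    have hpow : ∀ x : ℕ, x ≤ D → (x : ℝ) ^ (k * β) ≤ ((N : ℝ) / m) ^ β := by
      intro x hx
      rw [Real.rpow_mul (Nat.cast_nonneg x), Real.rpow_natCast]
      have : (x : ℝ) ^ k ≤ N / m := by
        rw [le_div_iff₀ hm0]
        exact le_trans (by gcongr) hDr
      gcongr
    rw [hsplit]
    calc _ ≤ |∑ d ∈ Icc 1 D, h d| + |∑ d ∈ Icc 1 Y, h d| := abs_sub _ _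
      _ ≤ C * (D : ℝ) ^ (k * β) + C * (Y : ℝ) ^ (k * β) :=
          add_le_add (hh D (by lia)) (hh Y hY)
      _ ≤ C * ((N : ℝ) / m) ^ β + C * ((N : ℝ) / m) ^ β := by
          gcongr
          · exact hpow D le_rfl
          · exact hpow Y hDY.le
      _ = _ := by ring

/-- The hyperbola method for `∑ h d * g m` over `d ^ k * m ≤ N`. -/
theorem abs_hyperbola_sum_le {g h : ℕ → ℝ} {C₁ C₂ β η y : ℝ} {k N : ℕ} (hk : k ≠ 0)
    (hg : ∀ n, |g n| ≤ 1) (hh : ∀ n, |h n| ≤ 1) (hC₁ : 0 ≤ C₁) (hC₂ : 0 ≤ C₂) (hβ : 0 ≤ β)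
    (hβ1 : β ≤ 1) (hη : 0 < η) (hy : 1 ≤ y) (hyN : y ≤ N)
    (hG : ∀ n : ℕ, 1 ≤ n → |∑ m ∈ Icc 1 n, g m| ≤ C₁ * (n : ℝ) ^ η)
    (hH : ∀ D : ℕ, 1 ≤ D → |∑ d ∈ Icc 1 D, h d| ≤ C₂ * (D : ℝ) ^ (k * β)) :
    |∑ d ∈ Icc 1 N, h d * ∑ m ∈ Icc 1 (N / d ^ k), g m| ≤ C₁ * (y * (N : ℝ) ^ η) +
      2 * C₂ * (∑' n : ℕ, 1 / (n : ℝ) ^ (1 + η)) *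
        ((N : ℝ) ^ β * ((N : ℝ) / y ^ k) ^ (1 - β + η)) := by
  have hy0 : 0 < y := by linarith
  set Y := ⌊y⌋₊ with hYdef
  have hY1 : 1 ≤ Y := (Nat.one_le_floor_iff y).2 hy
  have hYy : (Y : ℝ) ≤ y := Nat.floor_le hy0.le
  have hyY : y < Y + 1 := Nat.lt_floor_add_one y
  have hYN : Y ≤ N := by exact_mod_cast hYy.trans hyN
  have hI : ∀ n, Icc 1 n = Ioc 0 n := fun n => by ext; simp [Nat.lt_iff_add_one_le]
  set G : ℕ → ℝ := fun d => h d * ∑ m ∈ Icc 1 (N / d ^ k), g m with hGdef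
  have hsplit : ∑ d ∈ Icc 1 N, G d = ∑ d ∈ Icc 1 Y, G d + ∑ d ∈ Ioc Y N, G d := by
    rw [hI, hI, sum_Ioc_consecutive G (Nat.zero_le Y) hYN]
  have hfirst : |∑ d ∈ Icc 1 Y, G d| ≤ C₁ * (y * (N : ℝ) ^ η) := by
    refine (abs_sum_le_sum_abs _ _).trans ?_
    have : ∀ d ∈ Icc 1 Y, |G d| ≤ C₁ * (N : ℝ) ^ η := by
      intro d _
      simp only [G]
      rw [abs_mul]
      refine (mul_le_of_le_one_left (abs_nonneg _) (hh d)).trans ?_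
      rcases Nat.eq_zero_or_pos (N / d ^ k) with h0 | h0
      · rw [h0]
        simp only [zero_lt_one, Icc_eq_empty_of_lt, sum_empty, abs_zero]
        positivity
      · refine (hG _ h0).trans ?_
        have : N / d ^ k ≤ N := Nat.div_le_self _ _
        gcongr
    refine (sum_le_sum this).trans ?_
    rw [sum_const, Nat.card_Icc, nsmul_eq_mul, Nat.add_sub_cancel]
    calc (Y : ℝ) * (C₁ * (N : ℝ) ^ η) ≤ y * (C₁ * (N : ℝ) ^ η) := by gcongr
      _ = _ := by ring
  have hswap : ∑ d ∈ Ioc Y N, G d =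
      ∑ m ∈ Icc 1 N, g m * ∑ d ∈ Ioc Y N, if d ^ k * m ≤ N then h d else 0 := by
    have h1 : ∀ d ∈ Ioc Y N, G d =
        ∑ m ∈ Icc 1 N, g m * if d ^ k * m ≤ N then h d else 0 := by
      intro d hd
      have hd0 : 0 < d ^ k := pow_pos (by have := (mem_Ioc.1 hd).1; lia) k
      simp only [G, mul_ite, mul_zero]
      rw [← sum_filter, mul_sum]
      refine sum_congr ?_ fun m _ => mul_comm _ _
      ext m
      simp only [mem_filter, mem_Icc, Nat.le_div_iff_mul_le hd0]
      constructor
      · rintro ⟨h1, h2⟩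
        exact ⟨⟨h1, (Nat.le_mul_of_pos_right m hd0).trans h2⟩, by rwa [mul_comm]⟩
      · rintro ⟨⟨h1, -⟩, h2⟩
        exact ⟨h1, by rwa [mul_comm]⟩
    rw [sum_congr rfl h1, sum_comm]
    exact sum_congr rfl fun m _ => (mul_sum _ _ _).symm
  set Z : ℝ := (N : ℝ) / y ^ k with hZ
  have hZ0 : 0 ≤ Z := by positivity
  have hsecond : |∑ d ∈ Ioc Y N, G d| ≤ 2 * C₂ * (∑' n : ℕ, 1 / (n : ℝ) ^ (1 + η)) *
        ((N : ℝ) ^ β * Z ^ (1 - β + η)) := by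
    rw [hswap]
    refine (abs_sum_le_sum_abs _ _).trans ?_
    have hterm : ∀ m ∈ Icc 1 N, |g m * ∑ d ∈ Ioc Y N, if d ^ k * m ≤ N then h d else 0| ≤
        2 * C₂ * ((N : ℝ) ^ β * Z ^ (1 - β + η)) * (1 / (m : ℝ) ^ (1 + η)) := by
      intro m hm
      have hm1 := (mem_Icc.1 hm).1
      have hm0 : (0 : ℝ) < m := by exact_mod_cast hm1
      rw [abs_mul]
      refine (mul_le_of_le_one_left (abs_nonneg _) (hg m)).trans ?_
      refine (abs_sum_Ioc_ite_le hk hm1 hY1 hy0 hyY hC₂ hβ hH).trans ?_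
      split_ifs with hmZ
      · have h1 : (m : ℝ) ^ (1 - β + η) ≤ Z ^ (1 - β + η) :=
          Real.rpow_le_rpow hm0.le hmZ (by linarith)
        have h2 : ((N : ℝ) / m) ^ β =
            (N : ℝ) ^ β * (m : ℝ) ^ (1 - β + η) * (1 / (m : ℝ) ^ (1 + η)) := by
          rw [Real.div_rpow (Nat.cast_nonneg N) hm0.le, one_div, ← Real.rpow_neg hm0.le, mul_assoc,
            ← Real.rpow_add hm0, div_eq_mul_inv, ← Real.rpow_neg hm0.le]
          ring_nf
        rw [h2]
        calc 2 * C₂ * ((N : ℝ) ^ β * (m : ℝ) ^ (1 - β + η) * (1 / (m : ℝ) ^ (1 + η)))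
            ≤ 2 * C₂ * ((N : ℝ) ^ β * Z ^ (1 - β + η) * (1 / (m : ℝ) ^ (1 + η))) := by gcongr
          _ = _ := by ring
      · positivity
    refine (sum_le_sum hterm).trans ?_
    rw [← mul_sum]
    have := (Real.summable_one_div_nat_rpow.2 (by linarith : 1 < 1 + η)).sum_le_tsum (Icc 1 N)
      fun n _ => by positivity
    calc _ ≤ 2 * C₂ * ((N : ℝ) ^ β * Z ^ (1 - β + η)) * ∑' n : ℕ, 1 / (n : ℝ) ^ (1 + η) := by
          gcongr
      _ = _ := by ring
  calc _ = |∑ d ∈ Icc 1 Y, G d + ∑ d ∈ Ioc Y N, G d| := by rw [← hsplit]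
    _ ≤ _ := (abs_add_le _ _).trans (add_le_add hfirst hsecond)

theorem exists_abs_sum_kFreeModifiedCharacter_le (hGRH : GeneralizedRiemannHypothesis) {k : ℕ}
    (hk : 2 ≤ k) {q : ℕ} [NeZero q] (χ : DirichletCharacter ℤ q) (hχ : χ ≠ 1) {ε : ℝ}
    (hε : 0 < ε) :
    ∃ C : ℝ, 0 ≤ C ∧ ∀ N : ℕ, 1 ≤ N →
      |((∑ n ∈ Icc 1 N, kFreeModifiedCharacter k χ n : ℤ) : ℝ)| ≤
        C * (N : ℝ) ^ (1 / ((k : ℝ) + 1 / 2) + ε) := by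
  -- The cap at `1` guarantees `β ≤ 1`: it is at most `(3/2) / k`.
  set η : ℝ := min ε 1 with hη
  have hη0 : 0 < η := by positivity
  have hη1 : η ≤ 1 := min_le_right _ _
  have hηε : η ≤ ε := min_le_left _ _
  have hk2 : (2 : ℝ) ≤ k := by exact_mod_cast hk
  have hk0 : (0 : ℝ) < k := by linarith
  set α : ℝ := 1 / ((k : ℝ) + 1 / 2) with hα
  have hα0 : 0 < α := by positivity
  have hα1 : α ≤ 2 / 5 := by
    rw [hα, div_le_iff₀ (by positivity)]
    linarith
  have hkα : k * α = 1 - α / 2 := by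
    rw [hα]; field_simp; ring
  set β : ℝ := (1 / 2 + η) / k with hβ
  have hβ0 : 0 ≤ β := by positivity
  have hβ1 : β ≤ 1 := by
    rw [hβ, div_le_one hk0]; linarith
  have hkβ : k * β = 1 / 2 + η := by rw [hβ]; field_simp
  obtain ⟨C₁, hC₁, hG⟩ := exists_abs_sum_modifiedCharacter_le χ hχ hη0
  obtain ⟨C₂, hC₂, hH⟩ := exists_abs_sum_moebius_mul_modifiedCharacter_pow_le χ hGRH k hη0
  set S : ℝ := ∑' n : ℕ, 1 / (n : ℝ) ^ (1 + η) with hS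
  have hS0 : 0 ≤ S := tsum_nonneg fun n => by positivity
  refine ⟨C₁ + 2 * C₂ * S, by positivity, fun N hN => ?_⟩
  have hN1 : (1 : ℝ) ≤ N := by exact_mod_cast hN
  have hN0 : (0 : ℝ) < N := by linarith
  have habs : ∀ n, |(modifiedCharacter χ n : ℝ)| ≤ 1 := fun n => by
    exact_mod_cast (abs_modifiedCharacter χ n).le
  have hmain := abs_hyperbola_sum_le (g := fun n => (modifiedCharacter χ n : ℝ))
    (h := fun n => (μ n : ℝ) * (modifiedCharacter χ n : ℝ) ^ k) (y := (N : ℝ) ^ α) (N := N)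
    (k := k) (by lia) habs
    (fun n => by
      rw [abs_mul, abs_pow]
      refine mul_le_one₀ ?_ (by positivity) (pow_le_one₀ (abs_nonneg _) (habs n))
      exact_mod_cast ArithmeticFunction.abs_moebius_le_one)
    hC₁ hC₂ hβ0 hβ1 hη0 (Real.one_le_rpow hN1 hα0.le)
    (by
      calc (N : ℝ) ^ α ≤ (N : ℝ) ^ (1 : ℝ) :=
            Real.rpow_le_rpow_of_exponent_le hN1 (by linarith)
        _ = N := Real.rpow_one _)
    (fun n hn => by have := hG n hn; push_cast at this; exact this)
    (fun D hD => by have := hH D hD; push_cast at this; rw [hkβ]; exact this)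
  rw [sum_kFreeModifiedCharacter χ (by lia)]
  push_cast
  refine hmain.trans ?_
  have h1 : (N : ℝ) ^ α * (N : ℝ) ^ η ≤ (N : ℝ) ^ (α + ε) := by
    rw [← Real.rpow_add hN0]
    exact Real.rpow_le_rpow_of_exponent_le hN1 (by linarith)
  have h2 : (N : ℝ) ^ β * ((N : ℝ) / ((N : ℝ) ^ α) ^ k) ^ (1 - β + η) ≤ (N : ℝ) ^ (α + ε) := by
    -- With `y = N ^ α`, the definition of `α` amounts to `k * α = 1 - α / 2`, so `m` runs only up
    -- to `N ^ (α / 2)`.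
    have hZ : (N : ℝ) / ((N : ℝ) ^ α) ^ k = (N : ℝ) ^ (α / 2) := by
      rw [← Real.rpow_mul_natCast hN0.le, mul_comm α, hkα, Real.rpow_sub hN0, Real.rpow_one]
      field_simp
    rw [hZ, ← Real.rpow_mul hN0.le, ← Real.rpow_add hN0]
    refine Real.rpow_le_rpow_of_exponent_le hN1 ?_
    -- The main exponent is exactly `α`; the excess is below `ε` because `α ≤ 2/5` and `η ≤ ε`.
    have hexp : β + α / 2 * (1 - β + η) = α + 3 / 2 * (α * η) := by
      have : β * (1 - α / 2) = α * (1 / 2 + η) := by rw [← hkα, ← hkβ]; ring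
      linear_combination this
    rw [hexp]
    nlinarith
  calc _ ≤ C₁ * (N : ℝ) ^ (α + ε) + 2 * C₂ * S * (N : ℝ) ^ (α + ε) := by gcongr
    _ = _ := by ring

theorem partialSum_kFreeModifiedCharacter_isBigO (hGRH : GeneralizedRiemannHypothesis) {k : ℕ}
    (hk : 2 ≤ k) {q : ℕ} [NeZero q] (χ : DirichletCharacter ℤ q) (hχ : χ ≠ 1) {ε : ℝ}
    (hε : 0 < ε) :
    (fun x : ℝ => (partialSum (kFreeModifiedCharacter k χ) x : ℝ)) =O[Filter.atTop]
      fun x : ℝ => x ^ (1 / ((k : ℝ) + 1 / 2) + ε) := by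
  obtain ⟨C, hC, h⟩ := exists_abs_sum_kFreeModifiedCharacter_le hGRH hk χ hχ hε
  refine Asymptotics.IsBigO.of_bound C ?_
  filter_upwards [Filter.eventually_ge_atTop 1] with x hx
  rw [Real.norm_eq_abs, Real.norm_of_nonneg (by positivity), partialSum]
  refine (h _ ((Nat.one_le_floor_iff x).2 hx)).trans ?_
  gcongr
  exact Nat.floor_le (by linarith)

end

theorem theorem1p2 (hGRH : GeneralizedRiemannHypothesis) (k : ℕ) (hk : 2 ≤ k) :
    (∃ f : ArithmeticFunction ℤ, IsKFreeSignFunction k f ∧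
      ∀ ε : ℝ, 0 < ε →
        (fun x : ℝ => (partialSum f x : ℝ)) =O[Filter.atTop]
          fun x : ℝ => x ^ (1 / ((k : ℝ) + 1 / 2) + ε)) ∧
    (∀ (q : ℕ) [NeZero q] (χ : DirichletCharacter ℤ q), χ ≠ 1 →
      IsKFreeSignFunction k (kFreeModifiedCharacter k χ) ∧
      ∀ ε : ℝ, 0 < ε →
        (fun x : ℝ => (partialSum (kFreeModifiedCharacter k χ) x : ℝ)) =O[Filter.atTop]
          fun x : ℝ => x ^ (1 / ((k : ℝ) + 1 / 2) + ε)) := by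
  have main : ∀ (q : ℕ) [NeZero q] (χ : DirichletCharacter ℤ q), χ ≠ 1 →
      IsKFreeSignFunction k (kFreeModifiedCharacter k χ) ∧
      ∀ ε : ℝ, 0 < ε →
        (fun x : ℝ => (partialSum (kFreeModifiedCharacter k χ) x : ℝ)) =O[Filter.atTop]
          fun x : ℝ => x ^ (1 / ((k : ℝ) + 1 / 2) + ε) := fun q _ χ hχ =>
    ⟨isKFreeSignFunction_kFreeModifiedCharacter χ hk, fun _ hε =>
      partialSum_kFreeModifiedCharacter_isBigO hGRH hk χ hχ hε⟩
  -- Existence needs just one real non-principal character; the one modulo `4` takes the value `-1`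
  -- at `3`.
  have hχ₄ : ZMod.χ₄ ≠ 1 := fun h => by
    have h3 : ZMod.χ₄ 3 = (1 : MulChar (ZMod 4) ℤ) 3 := by rw [h]
    rw [MulChar.one_apply (by decide)] at h3
    exact absurd h3 (by decide)
  exact ⟨⟨_, main 4 ZMod.χ₄ hχ₄⟩, main⟩
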